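/- Let $f:\mathbb R\times\mathbb R\to\mathbb R$ satisfy: (i) $x\mapsto f(x,\omega)$ belongs to $L^\infty(\mathbb R)$ for every $\omega\in\mathbb R$, and $\omega\mapsto f(x,\omega)$ is smooth for every $x\in\mathbb R$; (ii) there is $L\ge 0$ with $|f(x,\omega_1)-f(x,\omega_2)|\le L|\omega_1-\omega_2|$ for all $x,\omega_1,\omega_2\in\mathbb R$; (iii) $\int_{\mathbb R}|f(x,0)|\,dx\le L_1$ for some constant $L_1\ge 0$. Let $\varepsilon>0$, and let $A^\varepsilon\subset L^1(\mathbb R)\times L^1(\mathbb R)$ be the operator with $(u,v)\in A^\varepsilon$ if and only if $[f(x,u)-\varepsilon u_x]_x=v$ weakly, that is, $$\int_{\mathbb R}\bigl(-f(x,u)\,\varphi'-\varepsilon u\,\varphi''\bigr)\,dx=\int_{\mathbb R}v\,\varphi\,dx\qquad\text{for all }\varphi\in C^2_c(\mathbb R).$$ Let $\mathcal D(A^\varepsilon)$ be its domain, and for $\lambda>0$ let $J^\varepsilon_\lambda=(I+\lambda A^\varepsilon)^{-1}$; also put $J^\varepsilon_0=I$. Then $\overline{\mathcal D(A^\varepsilon)}=L^1(\mathbb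 R)$, and $A^\varepsilon$ generates, in the sense of Crandall and Liggett, a continuous nonlinear semigroup of contractions $S^\varepsilon_t:L^1(\mathbb R)\to L^1(\mathbb R)$, $t\ge0$. This means: $A^\varepsilon$ is accretive, i.e. $\|(u_1+\lambda v_1)-(u_2+\lambda v_2)\|_{L^1}\ge\|u_1-u_2\|_{L^1}$ for all $(u_1,v_1),(u_2,v_2)\in A^\varepsilon$ and $\lambda>0$; there is $\lambda_0>0$ such that $I+\lambda A^\varepsilon$ maps onto $L^1(\mathbb R)$ for all $\lambda\in\,]0,\lambda_0]$; and for all $t,s\ge0$ and $u,u_1,u_2\in L^1(\mathbb R)$, $$S^\varepsilon_tu=\lim_{n\to\infty}\bigl(J^\varepsilon_{t/n}\bigr)^nu\ \text{ in }L^1(\mathbb R),\qquad S^\varepsilon_0u=u,\qquad S^\varepsilon_tS^\varepsilon_su=S^\varepsilon_{t+s}u,\qquad \|S^\varepsilon_tu_1-S^\varepsilon_tu_2\|_{L^1}\le\|u_1-u_2\|_{L^1},$$ and $t\mapsto S^\varepsilon_tu$ is continuous from $[0,\infty)$ to $L^1(\mathbb R)$. Moreover, for every $\bar u\in L^1(\mathbb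 R)$ the trajectory $u(t,x)=(S^\varepsilon_t\bar u)(x)$ belongs to $C^0([0,\infty),L^1(\mathbb R))$ and (for a suitable choice of representatives in $x$ of $S^\varepsilon_t\bar u$, $t\ge0$) is a weak solution of $u_t+f(x,u)_x=\varepsilon u_{xx}$ on $]0,\infty[\times\mathbb R$: $u$ and $f(x,u)$ are locally integrable there, and $$\int_0^\infty\!\!\int_{\mathbb R}\bigl(u\,\varphi_t+f(x,u)\,\varphi_x+\varepsilon u\,\varphi_{xx}\bigr)\,dx\,dt=0\qquad\text{for all }\varphi\in C^2_c(]0,\infty[\times\mathbb R).$$ -/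

import Mathlib

open MeasureTheory Set Filter Topology
open scoped NNReal ENNReal ContDiff

namespace NonlinearSemigroup

section Abstract

variable {X : Type*} [NormedAddCommGroup X] [NormedSpace ℝ X]

/-- The domain `{u | A u ≠ ∅}` of a (nonlinear, multivalued) operator, viewed as a subset
of `X × X`. -/
def domain (A : Set (X × X)) : Set X := {u | ∃ v, (u, v) ∈ A}

/-- Accretivity: `‖(u₁ + l v₁) - (u₂ + l v₂)‖ ≥ ‖u₁ - u₂‖` for `vᵢ ∈ A uᵢ`, `l > 0`. -/
def IsAccretive (A : Set (X × X)) : Prop :=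
  ∀ u₁ v₁ u₂ v₂ : X, (u₁, v₁) ∈ A → (u₂, v₂) ∈ A → ∀ l : ℝ, 0 < l →
    ‖u₁ - u₂‖ ≤ ‖(u₁ + l • v₁) - (u₂ + l • v₂)‖

/-- The backward Euler operator as a relation: `(w, u) ∈ J_l` iff `u + l v = w` for
some `v ∈ A u`. -/
def backwardEuler (A : Set (X × X)) (l : ℝ) : Set (X × X) :=
  {p | ∃ v, (p.2, v) ∈ A ∧ p.2 + l • v = p.1}

open Classical in
/-- The backward Euler operator as a map. For accretive `A` and `l > 0` the relation
`backwardEuler A l` is single valued, and this is its value wherever it is defined. Outside the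
domain of the relation we use the identity, which gives the usual convention `J_0 = I`. -/
noncomputable def J (A : Set (X × X)) (l : ℝ) (w : X) : X :=
  if h : ∃ u, (w, u) ∈ backwardEuler A l then h.choose else w

/-- `A` generates, in the sense of Crandall and Liggett, the continuous semigroup of
contractions `S` on the closure of the domain of `A`. -/
structure Generates (A : Set (X × X)) (S : ℝ≥0 → X → X) : Prop where
  accretive : IsAccretive A
  /-- The range condition: for small `l > 0`, `J_l` is defined on the closure of the domain. -/
  range : ∃ l₀ : ℝ, 0 < l₀ ∧ ∀ l : ℝ, 0 < l → l ≤ l₀ →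
    closure (domain A) ⊆ domain (backwardEuler A l)
  /-- The exponential formula `S_t u = lim (J_{t/n})^n u`. -/
  limit : ∀ u ∈ closure (domain A), ∀ t : ℝ≥0,
    Tendsto (fun n : ℕ => (J A ((t : ℝ) / (n : ℝ)))^[n] u) atTop (𝓝 (S t u))
  mapsTo : ∀ t : ℝ≥0, MapsTo (S t) (closure (domain A)) (closure (domain A))
  zero : ∀ u ∈ closure (domain A), S 0 u = u
  semigroup : ∀ u ∈ closure (domain A), ∀ t s : ℝ≥0, S t (S s u) = S (t + s) u
  continuous : ∀ u ∈ closure (domain A), Continuous (fun t : ℝ≥0 => S t u)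
  contraction : ∀ u₁ ∈ closure (domain A), ∀ u₂ ∈ closure (domain A), ∀ t : ℝ≥0,
    ‖S t u₁ - S t u₂‖ ≤ ‖u₁ - u₂‖

end Abstract

/-- The hypothesis on the flux `f (x, w)`: bounded (in `L^∞`) in `x`, smooth in `w`, uniformly
Lipschitz in `w`, and `f (·, 0)` integrable. -/
structure FluxHyp (f : ℝ → ℝ → ℝ) : Prop where
  bounded : ∀ w : ℝ, MemLp (fun x => f x w) ⊤ volume
  smooth : ∀ x : ℝ, ContDiff ℝ ∞ (f x)
  lipschitz : ∃ L : ℝ, 0 ≤ L ∧ ∀ x w₁ w₂ : ℝ, |f x w₁ - f x w₂| ≤ L * |w₁ - w₂|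
  integrable : ∃ L₁ : ℝ, 0 ≤ L₁ ∧ ∫⁻ x : ℝ, ENNReal.ofReal |f x 0| ≤ ENNReal.ofReal L₁

/-- The operator `u ↦ [f (x, u) - ε u_x]_x` in `L¹(ℝ)`, as a subset of `L¹ × L¹`. The equation
`[f (x, u) - ε u_x]_x = v` is meant in the weak sense, with test functions in `C²_c(ℝ)`. -/
def viscousOperator (f : ℝ → ℝ → ℝ) (ε : ℝ) : Set ((ℝ →₁[volume] ℝ) × (ℝ →₁[volume] ℝ)) :=
  {p | LocallyIntegrable (fun x : ℝ => f x (p.1 x)) volume ∧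
    ∀ φ : ℝ → ℝ, ContDiff ℝ 2 φ → HasCompactSupport φ →
      ∫ x : ℝ, (-(f x (p.1 x) * deriv φ x) - ε * p.1 x * deriv (deriv φ) x)
        = ∫ x : ℝ, p.2 x * φ x}

/-- `u = u (t, x)` is a weak solution of `u_t + f (x, u)_x = ε u_xx` on `]0, ∞[ × ℝ`. -/
def IsWeakSolution (f : ℝ → ℝ → ℝ) (ε : ℝ) (u : ℝ → ℝ → ℝ) : Prop :=
  LocallyIntegrableOn (fun p : ℝ × ℝ => u p.1 p.2) (Ioi 0 ×ˢ univ) volume ∧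
  LocallyIntegrableOn (fun p : ℝ × ℝ => f p.2 (u p.1 p.2)) (Ioi 0 ×ˢ univ) volume ∧
  ∀ φ : ℝ → ℝ → ℝ, ContDiff ℝ 2 (fun p : ℝ × ℝ => φ p.1 p.2) →
    HasCompactSupport (fun p : ℝ × ℝ => φ p.1 p.2) →
    tsupport (fun p : ℝ × ℝ => φ p.1 p.2) ⊆ Ioi 0 ×ˢ univ →
    ∫ p in (Ioi (0 : ℝ) ×ˢ (univ : Set ℝ)),
      (u p.1 p.2 * deriv (fun t => φ t p.2) p.1
        + f p.2 (u p.1 p.2) * deriv (φ p.1) p.2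
        + ε * u p.1 p.2 * deriv (deriv (φ p.1)) p.2) = 0

end NonlinearSemigroup

/-! The Crandall–Liggett theorem reduces the generation statement to three facts about the viscous
operator: accretivity, the range condition for small steps, and dense domain.

Accretivity is a Kato inequality. The difference `u` of two solutions satisfies `(h - ε u')' = v`
weakly with `|h| ≤ L |u|`. Integrating once gives `ε u' = h + W` with `W' = -v` and `W` bounded.
Differentiating `W · arctan (n u)`, a smoothed `W · sign u`, and completing a square leaves an error
at most `L² / (4 ε)` times `n u² / (1 + n² u²)`, whose integral vanishes as `n → ∞`. Hence `∫ v sign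
u ≥ 0` up to a vanishing error, which gives the contraction estimate in
`integral_abs_le_integral_abs_add`.

For the range condition, `u + l A u = w` is rewritten with `a² = l ε` as the fixed-point equation `u
= G w - l ∂G f(·, u)`, where `G = (1 - a² ∂²)⁻¹` is an explicit exponential convolution. Since `∂G`
has norm at most `1 / a` on `L¹`, the map is Lipschitz with constant `L √(l / ε)`, hence a
contraction for small `l`. When `w` is a test function, the solutions tend to `w` as `l → 0`, which
gives density.

The limit of the Euler scheme rests on `norm_iterate_J_sub_iterate_J_le`, which compares iterates
with two different steps.

For the weak equation, one Euler step tested against `ψ` is exactly `l` times the weak form at the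
new iterate. In the limit, `t ↦ ∫ S_t w ψ` has a right derivative, namely the weak form at `S_t w`.
A product rule handles time-dependent test functions, and the fundamental theorem of calculus for
right derivatives concludes. Joint measurability comes from taking the `x`-derivative of a jointly
continuous primitive as representative. -/

namespace NonlinearSemigroup

/-! ### The Crandall–Liggett generation theorem -/

section CrandallLiggett

variable {X : Type*} [NormedAddCommGroup X] [NormedSpace ℝ X]

/-- The range condition `R(I + l A) = X` for `0 < l ≤ l₀`. -/
def HasFullRange (A : Set (X × X)) (l₀ : ℝ) : Prop :=
  ∀ l : ℝ, 0 < l → l ≤ l₀ → ∀ w : X, ∃ u, (w, u) ∈ backwardEuler A l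

variable {A : Set (X × X)} {l₀ : ℝ}

theorem J_spec (hR : HasFullRange A l₀) {l : ℝ} (hl : 0 < l) (hl₀ : l ≤ l₀) (w : X) :
    (w, J A l w) ∈ backwardEuler A l := by
  have h := hR l hl hl₀ w
  rw [J, dif_pos h]
  exact h.choose_spec

theorem J_mem (hR : HasFullRange A l₀) {l : ℝ} (hl : 0 < l) (hl₀ : l ≤ l₀) (w : X) :
    (J A l w, l⁻¹ • (w - J A l w)) ∈ A := by
  obtain ⟨v, hv, he⟩ := J_spec hR hl hl₀ w
  simp only at he hv
  have : l⁻¹ • (w - J A l w) = v := by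
    rw [inv_smul_eq_iff₀ hl.ne', ← he]
    abel_nf
    simp [he]
  rwa [this]

theorem J_zero (w : X) : J A 0 w = w := by
  rw [J]
  split_ifs with h
  · obtain ⟨v, -, hv⟩ := h.choose_spec
    simpa using hv
  · rfl

theorem norm_J_sub_J_le (hA : IsAccretive A) (hR : HasFullRange A l₀) {l : ℝ} (hl : 0 < l)
    (hl₀ : l ≤ l₀) (w₁ w₂ : X) : ‖J A l w₁ - J A l w₂‖ ≤ ‖w₁ - w₂‖ := by
  obtain ⟨v₁, h₁, e₁⟩ := J_spec hR hl hl₀ w₁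
  obtain ⟨v₂, h₂, e₂⟩ := J_spec hR hl hl₀ w₂
  simp only at e₁ e₂
  have h := hA _ _ _ _ h₁ h₂ l hl
  rwa [e₁, e₂] at h

theorem norm_iterate_J_sub_le (hA : IsAccretive A) (hR : HasFullRange A l₀) {l : ℝ} (hl : 0 < l)
    (hl₀ : l ≤ l₀) (n : ℕ) (w₁ w₂ : X) : ‖(J A l)^[n] w₁ - (J A l)^[n] w₂‖ ≤ ‖w₁ - w₂‖ := by
  induction n with
  | zero => simp
  | succ n ih =>
    rw [Function.iterate_succ_apply', Function.iterate_succ_apply']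
    exact (norm_J_sub_J_le hA hR hl hl₀ _ _).trans ih

theorem norm_J_sub_self_le (hA : IsAccretive A) (hR : HasFullRange A l₀) {l : ℝ} (hl : 0 < l)
    (hl₀ : l ≤ l₀) {u v : X} (huv : (u, v) ∈ A) : ‖J A l u - u‖ ≤ l * ‖v‖ := by
  obtain ⟨v₁, h₁, e₁⟩ := J_spec hR hl hl₀ u
  simp only at e₁
  have h := hA _ _ _ _ h₁ huv l hl
  rw [e₁, sub_add_cancel_left, norm_neg, norm_smul, Real.norm_of_nonneg hl.le] at h
  exact h

theorem norm_iterate_J_sub_self_le (hA : IsAccretive A) (hR : HasFullRange A l₀) {l : ℝ}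
    (hl : 0 < l) (hl₀ : l ≤ l₀) {u v : X} (huv : (u, v) ∈ A) (n : ℕ) :
    ‖(J A l)^[n] u - u‖ ≤ n * l * ‖v‖ := by
  induction n with
  | zero => simp
  | succ n ih =>
    rw [Function.iterate_succ_apply]
    calc ‖(J A l)^[n] (J A l u) - u‖
        = ‖((J A l)^[n] (J A l u) - (J A l)^[n] u) + ((J A l)^[n] u - u)‖ := by congr 1; abel
      _ ≤ ‖J A l u - u‖ + ‖(J A l)^[n] u - u‖ :=
          (norm_add_le _ _).trans (by gcongr; exact norm_iterate_J_sub_le hA hR hl hl₀ n _ _)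
      _ ≤ l * ‖v‖ + n * l * ‖v‖ := by
          gcongr
          exact norm_J_sub_self_le hA hR hl hl₀ huv
      _ = _ := by push_cast; ring

/-- Accretivity with parameter `l m / (l + m)`: for this value the right-hand difference becomes a
convex combination of `J_l x - y` and `x - J_m y`. It is the recursion behind the comparison of two
schemes. -/
theorem norm_J_sub_J_le_convex (hA : IsAccretive A) (hR : HasFullRange A l₀) {l m : ℝ}
    (hl : 0 < l) (hl₀ : l ≤ l₀) (hm : 0 < m) (hm₀ : m ≤ l₀) (x y : X) :
    ‖J A l x - J A m y‖ ≤ l / (l + m) * ‖J A l x - y‖ + m / (l + m) * ‖x - J A m y‖ := by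
  have h := hA _ _ _ _ (J_mem hR hl hl₀ x) (J_mem hR hm hm₀ y) (l * m / (l + m)) (by positivity)
  refine h.trans ?_
  have hlm : l + m ≠ 0 := by positivity
  have e : (J A l x + (l * m / (l + m)) • l⁻¹ • (x - J A l x))
      - (J A m y + (l * m / (l + m)) • m⁻¹ • (y - J A m y))
      = (l / (l + m)) • (J A l x - y) + (m / (l + m)) • (x - J A m y) := by
    have h1 : l * m / (l + m) * l⁻¹ = m / (l + m) := by field_simp
    have h2 : l * m / (l + m) * m⁻¹ = l / (l + m) := by field_simp
    rw [smul_smul, smul_smul, h1, h2]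
    have h3 : l / (l + m) = 1 - m / (l + m) := by field_simp; ring
    rw [h3]
    module
  rw [e]
  refine (norm_add_le _ _).trans (le_of_eq ?_)
  rw [norm_smul, norm_smul, Real.norm_of_nonneg (by positivity), Real.norm_of_nonneg (by positivity)]

theorem convex_sqrt_le {l m a b : ℝ} (hl : 0 < l) (hm : 0 < m) (ha : 0 ≤ a) (hb : 0 ≤ b) :
    l / (l + m) * √a + m / (l + m) * √b ≤ √((l * a + m * b) / (l + m)) := by
  apply Real.le_sqrt_of_sq_le
  have h1 := Real.sq_sqrt ha
  have h2 := Real.sq_sqrt hb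
  set p := √a
  set q := √b
  have : l / (l + m) * p + m / (l + m) * q = (l * p + m * q) / (l + m) := by ring
  rw [this, div_pow, div_le_div_iff₀ (by positivity) (by positivity), ← h1, ← h2]
  nlinarith [mul_nonneg (mul_nonneg hl.le hm.le) (sq_nonneg (p - q)), add_pos hl hm,
    mul_nonneg (add_pos hl hm).le (mul_nonneg (mul_nonneg hl.le hm.le) (sq_nonneg (p - q)))]

/-- Double induction on the convex recursion, with concavity of the square root to merge the two
terms. The boundary cases `j = 0` and `k = 0` are the linear growth bound. -/
theorem norm_iterate_J_sub_iterate_J_le (hA : IsAccretive A) (hR : HasFullRange A l₀) {l m : ℝ}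
    (hl : 0 < l) (hl₀ : l ≤ l₀) (hm : 0 < m) (hm₀ : m ≤ l₀) {u v : X} (huv : (u, v) ∈ A)
    (j k : ℕ) :
    ‖(J A l)^[j] u - (J A m)^[k] u‖ ≤
      ‖v‖ * √((j * l - k * m) ^ 2 + j * l ^ 2 + k * m ^ 2) := by
  induction j generalizing k with
  | zero =>
    rw [Function.iterate_zero_apply, norm_sub_rev]
    refine (norm_iterate_J_sub_self_le hA hR hm hm₀ huv k).trans ?_
    rw [mul_comm]
    gcongr
    apply Real.le_sqrt_of_sq_le
    have : 0 ≤ (k : ℝ) * m ^ 2 := by positivity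
    push_cast
    nlinarith
  | succ j ihj =>
    induction k with
    | zero =>
      rw [Function.iterate_zero_apply]
      refine (norm_iterate_J_sub_self_le hA hR hl hl₀ huv (j + 1)).trans ?_
      rw [mul_comm]
      gcongr
      apply Real.le_sqrt_of_sq_le
      have : 0 ≤ ((j + 1 : ℕ) : ℝ) * l ^ 2 := by positivity
      push_cast at this ⊢
      nlinarith
    | succ k ihk =>
      rw [Function.iterate_succ_apply' _ j, Function.iterate_succ_apply' _ k]
      refine (norm_J_sub_J_le_convex hA hR hl hl₀ hm hm₀ _ _).trans ?_
      rw [← Function.iterate_succ_apply' (J A l) j, ← Function.iterate_succ_apply' (J A m) k]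
      have h1 := ihj (k + 1)
      calc _ ≤ l / (l + m) * (‖v‖ * √(((j + 1 : ℕ) * l - k * m) ^ 2 + (j + 1 : ℕ) * l ^ 2
              + k * m ^ 2)) + m / (l + m) * (‖v‖ * √((j * l - (k + 1 : ℕ) * m) ^ 2 + j * l ^ 2
              + (k + 1 : ℕ) * m ^ 2)) := by gcongr
        _ = ‖v‖ * (l / (l + m) * √(((j + 1 : ℕ) * l - k * m) ^ 2 + (j + 1 : ℕ) * l ^ 2
              + k * m ^ 2) + m / (l + m) * √((j * l - (k + 1 : ℕ) * m) ^ 2 + j * l ^ 2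
              + (k + 1 : ℕ) * m ^ 2)) := by ring
        _ ≤ _ := by
          gcongr
          -- The averaged radicands equal the new one exactly. With `D = (j+1) l - (k+1) m` the
          -- squares are `(D + m)²` and `(D - l)²`, of mean `D² + l m`; the linear terms lose
          -- exactly `l m`.
          refine (convex_sqrt_le hl hm (by positivity) (by positivity)).trans (le_of_eq ?_)
          congr 1
          have : l + m ≠ 0 := by positivity
          push_cast
          field_simp
          ring

theorem norm_iterate_J_sub_self_le_of_approx (hA : IsAccretive A) (hR : HasFullRange A l₀) {l : ℝ}
    (hl : 0 < l) (hl₀ : l ≤ l₀) {u v : X} (huv : (u, v) ∈ A) (n : ℕ) (w : X) :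
    ‖(J A l)^[n] w - w‖ ≤ 2 * ‖w - u‖ + n * l * ‖v‖ := by
  have h1 := norm_iterate_J_sub_le hA hR hl hl₀ n w u
  have h2 := norm_iterate_J_sub_self_le hA hR hl hl₀ huv n
  calc _ = ‖((J A l)^[n] w - (J A l)^[n] u) + ((J A l)^[n] u - u) + (u - w)‖ := by congr 1; abel
    _ ≤ _ := (norm_add₃_le).trans (by rw [norm_sub_rev u w]; linarith)

/-- The filter on pairs (step, number of steps) along which the step tends to `0` and the elapsed
time tends to `t`. -/
def eulerFilter (t : ℝ) : Filter (ℝ × ℕ) :=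
  comap Prod.fst (𝓝[>] 0) ⊓ comap (fun p => p.2 * p.1) (𝓝 t)

theorem tendsto_eulerFilter {ι : Type*} {F : Filter ι} {t : ℝ} {l : ι → ℝ} {m : ι → ℕ}
    (h0 : Tendsto l F (𝓝[>] 0)) (ht : Tendsto (fun i => m i * l i) F (𝓝 t)) :
    Tendsto (fun i => (l i, m i)) F (eulerFilter t) :=
  tendsto_inf.2 ⟨tendsto_comap_iff.2 h0, tendsto_comap_iff.2 ht⟩

/-- Besides nontriviality of the filter, this provides schemes with a step independent of `t`, so
that step counts for `t` and `s` can be added. -/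
theorem tendsto_floor_eulerFilter {t : ℝ} (ht : 0 ≤ t) :
    Tendsto (fun n : ℕ => (((n : ℝ) + 1)⁻¹, ⌊t * (n + 1)⌋₊)) atTop (eulerFilter t) := by
  have h0 : Tendsto (fun n : ℕ => ((n : ℝ) + 1)) atTop atTop :=
    tendsto_atTop_add_const_right _ _ tendsto_natCast_atTop_atTop
  refine tendsto_eulerFilter (tendsto_inv_atTop_nhdsGT_zero.comp h0) ?_
  simp_rw [← div_eq_mul_inv]
  exact (tendsto_nat_floor_mul_div_atTop ht).comp h0

theorem eulerFilter_neBot {t : ℝ} (ht : 0 ≤ t) : (eulerFilter t).NeBot :=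
  (tendsto_floor_eulerFilter ht).neBot

theorem eventually_eulerFilter_step {t r : ℝ} (hr : 0 < r) :
    ∀ᶠ p in eulerFilter t, 0 < p.1 ∧ p.1 ≤ r := by
  refine Filter.Eventually.filter_mono inf_le_left ?_
  have : ∀ᶠ l in 𝓝[>] (0 : ℝ), 0 < l ∧ l ≤ r := Ioc_mem_nhdsGT hr
  exact tendsto_comap.eventually this

theorem tendsto_step_eulerFilter (t : ℝ) : Tendsto Prod.fst (eulerFilter t) (𝓝 0) :=
  (tendsto_comap.mono_left inf_le_left).mono_right nhdsWithin_le_nhds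

theorem tendsto_time_eulerFilter (t : ℝ) :
    Tendsto (fun p : ℝ × ℕ => p.2 * p.1) (eulerFilter t) (𝓝 t) :=
  tendsto_comap.mono_left inf_le_right

/-- The radicand in the two-scheme bound is the squared difference of elapsed times plus, for each
scheme, elapsed time times step. All of these vanish along the filter. -/
theorem cauchy_map_iterate_J_of_mem (hA : IsAccretive A) (hR : HasFullRange A l₀) (h₀ : 0 < l₀)
    {t : ℝ} (ht : 0 ≤ t) {u v : X} (huv : (u, v) ∈ A) :
    Cauchy (map (fun p : ℝ × ℕ => (J A p.1)^[p.2] u) (eulerFilter t)) := by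
  have := eulerFilter_neBot ht
  rw [cauchy_map_iff]
  refine ⟨this, ?_⟩
  rw [tendsto_uniformity_iff_dist_tendsto_zero]
  have hs1 : Tendsto (fun p : (ℝ × ℕ) × (ℝ × ℕ) => p.1.1) (eulerFilter t ×ˢ eulerFilter t) (𝓝 0) :=
    (tendsto_step_eulerFilter t).comp tendsto_fst
  have hs2 : Tendsto (fun p : (ℝ × ℕ) × (ℝ × ℕ) => p.2.1) (eulerFilter t ×ˢ eulerFilter t) (𝓝 0) :=
    (tendsto_step_eulerFilter t).comp tendsto_snd
  have ht1 : Tendsto (fun p : (ℝ × ℕ) × (ℝ × ℕ) => (p.1.2 : ℝ) * p.1.1)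
      (eulerFilter t ×ˢ eulerFilter t) (𝓝 t) := (tendsto_time_eulerFilter t).comp tendsto_fst
  have ht2 : Tendsto (fun p : (ℝ × ℕ) × (ℝ × ℕ) => (p.2.2 : ℝ) * p.2.1)
      (eulerFilter t ×ˢ eulerFilter t) (𝓝 t) := (tendsto_time_eulerFilter t).comp tendsto_snd
  have hlim : Tendsto (fun p : (ℝ × ℕ) × (ℝ × ℕ) => ‖v‖ * √((p.1.2 * p.1.1 - p.2.2 * p.2.1) ^ 2
      + p.1.2 * p.1.1 * p.1.1 + p.2.2 * p.2.1 * p.2.1)) (eulerFilter t ×ˢ eulerFilter t) (𝓝 0) := by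
    have := (((((ht1.sub ht2).pow 2).add (ht1.mul hs1)).add (ht2.mul hs2)).sqrt).const_mul ‖v‖
    simpa using this
  refine squeeze_zero' (Eventually.of_forall fun _ => dist_nonneg) ?_ hlim
  have h1 := (eventually_eulerFilter_step (t := t) h₀)
  filter_upwards [h1.prod_mk h1] with p hp
  rw [dist_eq_norm]
  refine (norm_iterate_J_sub_iterate_J_le hA hR hp.1.1 hp.1.2 hp.2.1 hp.2.2 huv _ _).trans
    (le_of_eq ?_)
  congr 2
  ring

theorem cauchy_map_iterate_J (hA : IsAccretive A) (hR : HasFullRange A l₀) (h₀ : 0 < l₀)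
    (hd : closure (domain A) = univ) {t : ℝ} (ht : 0 ≤ t) (w : X) :
    Cauchy (map (fun p : ℝ × ℕ => (J A p.1)^[p.2] w) (eulerFilter t)) := by
  have hne := eulerFilter_neBot ht
  rw [cauchy_map_iff]
  refine ⟨hne, ?_⟩
  rw [Metric.uniformity_basis_dist.tendsto_right_iff]
  intro r hr
  obtain ⟨u, ⟨v, huv⟩, hu⟩ := Metric.mem_closure_iff.1 (hd ▸ mem_univ w : w ∈ closure (domain A))
    (r / 3) (by positivity)
  have h1 := (cauchy_map_iff.1 (cauchy_map_iterate_J_of_mem hA hR h₀ ht huv)).2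
  rw [Metric.uniformity_basis_dist.tendsto_right_iff] at h1
  have h2 := (eventually_eulerFilter_step (t := t) h₀)
  filter_upwards [h1 (r / 3) (by positivity), h2.prod_mk h2] with p hp hp'
  change dist _ _ < _ at hp
  have e1 := norm_iterate_J_sub_le hA hR hp'.1.1 hp'.1.2 p.1.2 w u
  have e2 := norm_iterate_J_sub_le hA hR hp'.2.1 hp'.2.2 p.2.2 u w
  rw [← dist_eq_norm, ← dist_eq_norm] at e1 e2
  rw [dist_comm u w] at e2
  have := dist_triangle4 ((J A p.1.1)^[p.1.2] w) ((J A p.1.1)^[p.1.2] u) ((J A p.2.1)^[p.2.2] u)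
    ((J A p.2.1)^[p.2.2] w)
  linarith

/-- The Crandall–Liggett semigroup, the limit of the backward Euler scheme. -/
noncomputable def semigroup (A : Set (X × X)) (t : ℝ≥0) (w : X) : X :=
  limUnder (eulerFilter t) (fun p : ℝ × ℕ => (J A p.1)^[p.2] w)

variable [CompleteSpace X]

theorem tendsto_iterate_J (hA : IsAccretive A) (hR : HasFullRange A l₀) (h₀ : 0 < l₀)
    (hd : closure (domain A) = univ) (t : ℝ≥0) (w : X) :
    Tendsto (fun p : ℝ × ℕ => (J A p.1)^[p.2] w) (eulerFilter t) (𝓝 (semigroup A t w)) :=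
  tendsto_nhds_limUnder
    (haveI := eulerFilter_neBot t.2
    cauchy_map_iff_exists_tendsto.1 (cauchy_map_iterate_J hA hR h₀ hd t.2 w))

theorem norm_semigroup_sub_le (hA : IsAccretive A) (hR : HasFullRange A l₀) (h₀ : 0 < l₀)
    (hd : closure (domain A) = univ) (t : ℝ≥0) (w₁ w₂ : X) :
    ‖semigroup A t w₁ - semigroup A t w₂‖ ≤ ‖w₁ - w₂‖ := by
  have : (eulerFilter (t : ℝ)).NeBot := eulerFilter_neBot t.2
  refine le_of_tendsto ((tendsto_iterate_J hA hR h₀ hd t w₁).sub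
    (tendsto_iterate_J hA hR h₀ hd t w₂)).norm ?_
  filter_upwards [eventually_eulerFilter_step h₀] with p hp
  exact norm_iterate_J_sub_le hA hR hp.1 hp.2 _ _ _

theorem semigroup_zero (hA : IsAccretive A) (hR : HasFullRange A l₀) (h₀ : 0 < l₀)
    (hd : closure (domain A) = univ) (w : X) : semigroup A 0 w = w := by
  have h := (tendsto_iterate_J hA hR h₀ hd 0 w).comp (tendsto_floor_eulerFilter le_rfl)
  refine tendsto_nhds_unique h (tendsto_const_nhds.congr fun n => ?_)
  simp

theorem tendsto_iterate_J_div (hA : IsAccretive A) (hR : HasFullRange A l₀) (h₀ : 0 < l₀)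
    (hd : closure (domain A) = univ) (t : ℝ≥0) (w : X) :
    Tendsto (fun n : ℕ => (J A ((t : ℝ) / (n : ℝ)))^[n] w) atTop (𝓝 (semigroup A t w)) := by
  -- The filter requires positive steps, so `t = 0` is separate: there every step is `0` and `J_0`
  -- is the identity.
  rcases eq_or_ne t 0 with rfl | ht
  · rw [semigroup_zero hA hR h₀ hd]
    refine tendsto_const_nhds.congr fun n => ?_
    have : J A 0 = (id : X → X) := funext J_zero
    simp [this]
  · have htp : (0 : ℝ) < t := by positivity
    suffices key : Tendsto (fun n : ℕ => ((t : ℝ) / (n : ℝ), n)) atTop (eulerFilter (t : ℝ)) by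
      have h := Tendsto.comp (tendsto_iterate_J hA hR h₀ hd t w) key
      simp only [Function.comp_def] at h
      exact h
    refine tendsto_eulerFilter ?_ ?_
    · refine tendsto_nhdsWithin_iff.2 ⟨tendsto_const_div_atTop_nhds_zero_nat _, ?_⟩
      filter_upwards [eventually_gt_atTop 0] with n hn
      have : (0 : ℝ) < n := by exact_mod_cast hn
      exact div_pos htp this
    · refine tendsto_const_nhds.congr' ?_
      filter_upwards [eventually_gt_atTop 0] with n hn
      have : (0 : ℝ) < n := by exact_mod_cast hn
      field_simp

/-- Both evolutions use the step `1 / (n + 1)`, and the added floor counts still have elapsed time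
tending to `t + s`. Nonexpansiveness of the iterates allows the inner iterate to be replaced by its
limit `S_s w`. -/
theorem semigroup_semigroup (hA : IsAccretive A) (hR : HasFullRange A l₀) (h₀ : 0 < l₀)
    (hd : closure (domain A) = univ) (t s : ℝ≥0) (w : X) :
    semigroup A t (semigroup A s w) = semigroup A (t + s) w := by
  have ht := tendsto_floor_eulerFilter t.2
  have hs := tendsto_floor_eulerFilter s.2
  have hts : Tendsto (fun n : ℕ => (((n : ℝ) + 1)⁻¹, ⌊(t : ℝ) * (n + 1)⌋₊ + ⌊(s : ℝ) * (n + 1)⌋₊))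
      atTop (eulerFilter ((t + s : ℝ≥0) : ℝ)) := by
    refine tendsto_eulerFilter ?_ ?_
    · exact tendsto_inv_atTop_nhdsGT_zero.comp
        (tendsto_atTop_add_const_right _ _ tendsto_natCast_atTop_atTop)
    · have := ((tendsto_time_eulerFilter t).comp ht).add ((tendsto_time_eulerFilter s).comp hs)
      rw [NNReal.coe_add]
      refine this.congr fun n => ?_
      simp
      ring
  have h1 := (tendsto_iterate_J hA hR h₀ hd t (semigroup A s w)).comp ht
  have h2 := (tendsto_iterate_J hA hR h₀ hd s w).comp hs
  have h3 := (tendsto_iterate_J hA hR h₀ hd (t + s) w).comp hts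
  refine tendsto_nhds_unique h1 ?_
  refine h3.congr_dist ?_
  rw [tendsto_iff_dist_tendsto_zero] at h2
  refine squeeze_zero' (Eventually.of_forall fun _ => dist_nonneg) ?_ h2
  filter_upwards [ht.eventually (eventually_eulerFilter_step h₀)] with n hn
  simp only [Function.comp_apply, Function.iterate_add_apply]
  rw [dist_eq_norm, dist_eq_norm]
  exact norm_iterate_J_sub_le hA hR hn.1 hn.2 _ _ _

theorem norm_semigroup_sub_self_le (hA : IsAccretive A) (hR : HasFullRange A l₀) (h₀ : 0 < l₀)
    (hd : closure (domain A) = univ) (t : ℝ≥0) {u v : X} (huv : (u, v) ∈ A) (w : X) :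
    ‖semigroup A t w - w‖ ≤ 2 * ‖w - u‖ + t * ‖v‖ := by
  have : (eulerFilter (t : ℝ)).NeBot := eulerFilter_neBot t.2
  refine le_of_tendsto_of_tendsto ((tendsto_iterate_J hA hR h₀ hd t w).sub_const w).norm
    (((tendsto_time_eulerFilter t).mul_const ‖v‖).const_add (2 * ‖w - u‖)) ?_
  filter_upwards [eventually_eulerFilter_step h₀] with p hp
  exact norm_iterate_J_sub_self_le_of_approx hA hR hp.1 hp.2 huv _ _

theorem continuous_semigroup (hA : IsAccretive A) (hR : HasFullRange A l₀) (h₀ : 0 < l₀)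
    (hd : closure (domain A) = univ) (w : X) : Continuous (fun t : ℝ≥0 => semigroup A t w) := by
  have key : ∀ r > 0, ∃ d > 0, ∀ t : ℝ≥0, (t : ℝ) < d → ‖semigroup A t w - w‖ < r := by
    intro r hr
    obtain ⟨u, ⟨v, huv⟩, hu⟩ := Metric.mem_closure_iff.1
      (hd ▸ mem_univ w : w ∈ closure (domain A)) (r / 4) (by positivity)
    rw [dist_eq_norm] at hu
    refine ⟨r / (2 * (‖v‖ + 1)), by positivity, fun t ht => ?_⟩
    refine (norm_semigroup_sub_self_le hA hR h₀ hd t huv w).trans_lt ?_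
    have : (t : ℝ) * ‖v‖ ≤ r / 2 := by
      calc (t : ℝ) * ‖v‖ ≤ r / (2 * (‖v‖ + 1)) * (‖v‖ + 1) := by gcongr; linarith
        _ = r / 2 := by field_simp
    linarith
  -- The semigroup law and contraction reduce continuity at any time to continuity at time `0`.
  have key2 : ∀ s t : ℝ≥0, s ≤ t →
      ‖semigroup A t w - semigroup A s w‖ ≤ ‖semigroup A (t - s) w - w‖ := by
    intro s t hst
    have : semigroup A t w = semigroup A s (semigroup A (t - s) w) := by
      rw [semigroup_semigroup hA hR h₀ hd, add_tsub_cancel_of_le hst]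
    rw [this]
    exact norm_semigroup_sub_le hA hR h₀ hd _ _ _
  rw [Metric.continuous_iff]
  intro t r hr
  obtain ⟨d, hd0, h⟩ := key r hr
  refine ⟨d, hd0, fun s hs => ?_⟩
  rw [NNReal.dist_eq] at hs
  rw [dist_eq_norm]
  rcases le_total s t with hst | hst
  · rw [norm_sub_rev]
    refine (key2 s t hst).trans_lt (h _ ?_)
    rw [NNReal.coe_sub hst]
    exact (neg_sub (s : ℝ) t ▸ neg_le_abs _).trans_lt hs
  · refine (key2 t s hst).trans_lt (h _ ?_)
    rw [NNReal.coe_sub hst]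
    exact (le_abs_self _).trans_lt hs

/-- The Crandall–Liggett generation theorem for densely defined operators. -/
theorem generates_semigroup (hA : IsAccretive A) (hR : HasFullRange A l₀) (h₀ : 0 < l₀)
    (hd : closure (domain A) = univ) : Generates A (semigroup A) where
  accretive := hA
  range := ⟨l₀, h₀, fun l hl hl₀ w _ => hR l hl hl₀ w⟩
  limit u _ t := tendsto_iterate_J_div hA hR h₀ hd t u
  mapsTo t := by rw [hd]; exact mapsTo_univ _ _
  zero u _ := semigroup_zero hA hR h₀ hd u
  semigroup u _ t s := semigroup_semigroup hA hR h₀ hd t s u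
  continuous u _ := continuous_semigroup hA hR h₀ hd u
  contraction u₁ _ u₂ _ t := norm_semigroup_sub_le hA hR h₀ hd t u₁ u₂

end CrandallLiggett

/-! ### Primitives and du Bois-Reymond lemmas -/

section Regularity

theorem _root_.MeasureTheory.LocallyIntegrable.intervalIntegrable' {k : ℝ → ℝ}
    (hk : LocallyIntegrable k volume) (a b : ℝ) : IntervalIntegrable k volume a b :=
  (hk.integrableOn_isCompact isCompact_uIcc).intervalIntegrable

theorem absolutelyContinuous_primitive {k : ℝ → ℝ} (hk : LocallyIntegrable k volume) (a b : ℝ) :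
    AbsolutelyContinuousOnInterval (fun x => ∫ y in (0 : ℝ)..x, k y) a b := by
  have h := (hk.intervalIntegrable' (min 0 (min a b)) (max 0 (max a b))).absolutelyContinuousOnInterval_intervalIntegral
    (c := 0) (by simp)
  refine h.mono ?_
  rw [uIcc_of_le (a := min 0 (min a b)) (by simp)]
  exact Icc_subset_Icc (by simp) (by simp)

theorem continuous_primitive' {k : ℝ → ℝ} (hk : LocallyIntegrable k volume) :
    Continuous (fun x => ∫ y in (0 : ℝ)..x, k y) :=
  intervalIntegral.continuous_primitive hk.intervalIntegrable' 0

theorem exists_support_subset_Ioc {φ : ℝ → ℝ} (hc : HasCompactSupport φ) :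
    ∃ R : ℝ, 0 < R ∧ ∀ x, x ∉ Ioo (-R) R → φ x = 0 := by
  obtain ⟨R, hR0, hR⟩ := hc.isCompact.isBounded.subset_ball_lt 0 0
  refine ⟨R, hR0, fun x hx => ?_⟩
  by_contra h
  apply hx
  have := hR (subset_tsupport φ (Function.mem_support.2 h))
  rwa [Real.ball_eq_Ioo, zero_sub, zero_add] at this

theorem integral_mul_eq_neg_integral_primitive_mul_deriv {k φ : ℝ → ℝ}
    (hk : LocallyIntegrable k volume) (hφ : ContDiff ℝ 1 φ) (hc : HasCompactSupport φ) :
    ∫ x, k x * φ x = -∫ x, (∫ y in (0 : ℝ)..x, k y) * deriv φ x := by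
  obtain ⟨R, hR0, hR⟩ := exists_support_subset_Ioc hc
  obtain ⟨R', hR0', hR'⟩ := exists_support_subset_Ioc hc.deriv
  set T := max R R' with hT
  have hz : ∀ x, x ∉ Ioo (-T) T → φ x = 0 := fun x hx => hR x fun h => hx
    ⟨by linarith [h.1, le_max_left R R'], by linarith [h.2, le_max_left R R']⟩
  have hz' : ∀ x, x ∉ Ioo (-T) T → deriv φ x = 0 := fun x hx => hR' x fun h => hx
    ⟨by linarith [h.1, le_max_right R R'], by linarith [h.2, le_max_right R R']⟩
  have e1 : ∫ x in (-T)..T, k x * φ x = ∫ x, k x * φ x := by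
    apply intervalIntegral.integral_eq_integral_of_support_subset
    intro x hx
    by_contra h
    exact hx (by simp [hz x fun h' => h (Ioo_subset_Ioc_self h')])
  have e2 : ∫ x in (-T)..T, (∫ y in (0 : ℝ)..x, k y) * deriv φ x
      = ∫ x, (∫ y in (0 : ℝ)..x, k y) * deriv φ x := by
    apply intervalIntegral.integral_eq_integral_of_support_subset
    intro x hx
    by_contra h
    exact hx (by simp [hz' x fun h' => h (Ioo_subset_Ioc_self h')])
  have hac := absolutelyContinuous_primitive hk (-T) T
  have hac' : AbsolutelyContinuousOnInterval φ (-T) T :=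
    hφ.contDiffOn.absolutelyContinuousOnInterval
  have := hac.integral_mul_deriv_eq_deriv_mul hac'
  rw [hz T (by simp), hz (-T) (by simp), e2] at this
  rw [this, ← e1]
  simp only [mul_zero, sub_self, zero_sub, neg_neg]
  apply intervalIntegral.integral_congr_ae
  filter_upwards [LocallyIntegrable.ae_hasDerivAt_integral hk] with x hx _
  rw [(hx 0).deriv]

theorem exists_bump_integral_eq_one :
    ∃ ρ : ℝ → ℝ, ContDiff ℝ ∞ ρ ∧ HasCompactSupport ρ ∧ ∫ x, ρ x = 1 := by
  let b : ContDiffBump (0 : ℝ) := default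
  exact ⟨b.normed volume, b.contDiff_normed, b.hasCompactSupport_normed, b.integral_normed⟩

theorem exists_antideriv_of_integral_eq_zero {ψ : ℝ → ℝ} (hψ : ContDiff ℝ ∞ ψ)
    (hc : HasCompactSupport ψ) (h0 : ∫ x, ψ x = 0) :
    ∃ φ : ℝ → ℝ, ContDiff ℝ ∞ φ ∧ HasCompactSupport φ ∧ deriv φ = ψ := by
  obtain ⟨R, hR0, hR⟩ := exists_support_subset_Ioc hc
  have hder : ∀ x, HasDerivAt (fun x => ∫ y in (-R)..x, ψ y) (ψ x) x := fun x =>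
    hψ.continuous.integral_hasStrictDerivAt (-R) x |>.hasDerivAt
  have hderiv : deriv (fun x => ∫ y in (-R)..x, ψ y) = ψ := funext fun x => (hder x).deriv
  refine ⟨fun x => ∫ y in (-R)..x, ψ y, ?_, ?_, hderiv⟩
  · rw [contDiff_infty_iff_deriv]
    exact ⟨fun x => (hder x).differentiableAt, by rwa [hderiv]⟩
  · refine HasCompactSupport.of_support_subset_isCompact (isCompact_Icc (a := -R) (b := R)) ?_
    intro x hx
    by_contra hx'
    apply hx
    rw [mem_Icc, not_and_or, not_le, not_le] at hx'
    rcases hx' with hx' | hx'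
    · show ∫ y in (-R)..x, ψ y = 0
      rw [intervalIntegral.integral_symm, neg_eq_zero]
      rw [intervalIntegral.integral_congr (g := fun _ => 0)]
      · simp
      · intro y hy
        rw [uIcc_of_le hx'.le] at hy
        exact hR y (fun h => by linarith [h.1, hy.2])
    · show ∫ y in (-R)..x, ψ y = 0
      rw [intervalIntegral.integral_eq_integral_of_support_subset, h0]
      intro y hy
      by_contra hy'
      refine hy (hR y fun h => hy' ⟨h.1, by linarith [h.2]⟩)

/-- If `ρ` has integral one, `ψ - (∫ ψ) ρ` has mean zero and is therefore the derivative of a test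
function, which `Λ` kills. Only the linearity needed for this subtraction is assumed. -/
theorem exists_eq_const_mul_integral (Λ : (ℝ → ℝ) → ℝ)
    (hsub : ∀ (m : ℝ) (φ ψ : ℝ → ℝ), ContDiff ℝ ∞ φ → HasCompactSupport φ → ContDiff ℝ ∞ ψ →
      HasCompactSupport ψ → Λ (fun x => φ x - m * ψ x) = Λ φ - m * Λ ψ)
    (hder : ∀ φ : ℝ → ℝ, ContDiff ℝ ∞ φ → HasCompactSupport φ → Λ (deriv φ) = 0) :
    ∃ c : ℝ, ∀ ψ : ℝ → ℝ, ContDiff ℝ ∞ ψ → HasCompactSupport ψ → Λ ψ = c * ∫ x, ψ x := by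
  obtain ⟨ρ, hρ, hρc, hρ1⟩ := exists_bump_integral_eq_one
  refine ⟨Λ ρ, fun ψ hψ hψc => ?_⟩
  have hi : Integrable ψ := hψ.continuous.integrable_of_hasCompactSupport hψc
  have hiρ : Integrable ρ := hρ.continuous.integrable_of_hasCompactSupport hρc
  obtain ⟨φ, hφ, hφc, hd⟩ := exists_antideriv_of_integral_eq_zero
    (ψ := fun x => ψ x - (∫ x, ψ x) * ρ x) (hψ.sub (contDiff_const.mul hρ))
    (hψc.sub hρc.mul_left) (by
      rw [integral_sub hi (hiρ.const_mul _), integral_const_mul, hρ1, mul_one, sub_self])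
  have h1 := hder φ hφ hφc
  rw [hd, hsub _ _ _ hψ hψc hρ hρc] at h1
  linarith

theorem _root_.MeasureTheory.LocallyIntegrable.integrable_mul_of_hasCompactSupport {k φ : ℝ → ℝ}
    (hk : LocallyIntegrable k volume) (hφ : Continuous φ) (hc : HasCompactSupport φ) :
    Integrable (fun x => k x * φ x) := by
  simpa [mul_comm] using hk.integrable_smul_left_of_hasCompactSupport hφ hc

theorem contDiff_deriv_infty {φ : ℝ → ℝ} (hφ : ContDiff ℝ ∞ φ) : ContDiff ℝ ∞ (deriv φ) :=
  (contDiff_infty_iff_deriv.1 hφ).2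

/-- A second order du Bois-Reymond lemma. -/
theorem exists_ae_eq_primitive {p g : ℝ → ℝ} (hp : LocallyIntegrable p volume)
    (hg : LocallyIntegrable g volume)
    (h : ∀ φ : ℝ → ℝ, ContDiff ℝ ∞ φ → HasCompactSupport φ →
      ∫ x, (p x * deriv φ x + g x * deriv (deriv φ) x) = 0) :
    ∃ c d : ℝ, g =ᵐ[volume] fun x => d + ∫ y in (0 : ℝ)..x, (p y - c) := by
  have hint : ∀ {φ : ℝ → ℝ}, ContDiff ℝ ∞ φ → HasCompactSupport φ →
      Integrable (fun x => p x * φ x) ∧ Integrable (fun x => g x * deriv φ x) :=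
    fun hφ hφc => ⟨hp.integrable_mul_of_hasCompactSupport hφ.continuous hφc,
      hg.integrable_mul_of_hasCompactSupport (contDiff_deriv_infty hφ).continuous hφc.deriv⟩
  -- By hypothesis, `ψ ↦ ∫ (p ψ + g ψ')` kills derivatives; `c` is its proportionality constant.
  obtain ⟨c, hc⟩ := exists_eq_const_mul_integral
    (fun ψ => ∫ x, (p x * ψ x + g x * deriv ψ x)) (by
      intro m φ ψ hφ hφc hψ hψc
      have i1 := (hint hφ hφc).1.add (hint hφ hφc).2
      have i2 := (hint hψ hψc).1.add (hint hψ hψc).2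
      simp only [Pi.add_def] at i1 i2
      rw [← integral_const_mul, ← integral_sub i1 (i2.const_mul m)]
      congr 1
      ext x
      have : deriv (fun x => φ x - m * ψ x) x = deriv φ x - m * deriv ψ x := by
        have h1 := (hφ.differentiable (by simp) x).hasDerivAt
        have h2 := (hψ.differentiable (by simp) x).hasDerivAt
        exact (h1.sub (h2.const_mul m)).deriv
      rw [this]
      ring) h
  have hpc : LocallyIntegrable (fun x => p x - c) volume := hp.sub (locallyIntegrable_const c)
  have hP : LocallyIntegrable (fun x => ∫ y in (0 : ℝ)..x, (p y - c)) volume :=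
    (continuous_primitive' hpc).locallyIntegrable
  -- The function `q` has weak derivative zero, so a second application of the same principle makes
  -- it a constant `d`.
  set q : ℝ → ℝ := fun x => g x - ∫ y in (0 : ℝ)..x, (p y - c) with hq
  have hqi : LocallyIntegrable q volume := hg.sub hP
  have hq0 : ∀ φ : ℝ → ℝ, ContDiff ℝ ∞ φ → HasCompactSupport φ → ∫ x, q x * deriv φ x = 0 := by
    intro φ hφ hφc
    have h1 := hc φ hφ hφc
    rw [integral_add (hint hφ hφc).1 (hint hφ hφc).2] at h1
    have h2 := integral_mul_eq_neg_integral_primitive_mul_deriv hpc (hφ.of_le (by simp)) hφc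
    have e : ∀ x, q x * deriv φ x = g x * deriv φ x
      - (∫ y in (0 : ℝ)..x, (p y - c)) * deriv φ x := fun x => by simp only [hq]; ring
    simp_rw [e]
    rw [integral_sub (hint hφ hφc).2 (hP.integrable_mul_of_hasCompactSupport
      (contDiff_deriv_infty hφ).continuous hφc.deriv)]
    have h3 : ∫ x, (p x - c) * φ x = (∫ x, p x * φ x) - c * ∫ x, φ x := by
      rw [← integral_const_mul, ← integral_sub (hint hφ hφc).1
        ((hφ.continuous.integrable_of_hasCompactSupport hφc).const_mul c)]
      congr 1
      ext x
      ring
    linarith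
  obtain ⟨d, hd⟩ := exists_eq_const_mul_integral (fun ψ => ∫ x, q x * ψ x) (by
      intro m φ ψ hφ hφc hψ hψc
      rw [← integral_const_mul, ← integral_sub
        (hqi.integrable_mul_of_hasCompactSupport hφ.continuous hφc)
        ((hqi.integrable_mul_of_hasCompactSupport hψ.continuous hψc).const_mul m)]
      congr 1
      ext x
      ring) hq0
  have hae := ae_eq_of_integral_contDiff_smul_eq hqi (locallyIntegrable_const d) (by
    intro φ hφ hφc
    have := hd φ hφ hφc
    simp only [smul_eq_mul, mul_comm (φ _)] at this ⊢
    rw [this, integral_const_mul])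
  refine ⟨c, d, ?_⟩
  filter_upwards [hae] with x hx
  simp only [hq] at hx
  linarith

/-! ### Kato's inequality and the `L¹` contraction estimate -/

theorem _root_.AbsolutelyContinuousOnInterval.lipschitz_comp {η g : ℝ → ℝ} {K : ℝ≥0} {a b : ℝ}
    (hη : LipschitzWith K η) (hg : AbsolutelyContinuousOnInterval g a b) :
    AbsolutelyContinuousOnInterval (fun x => η (g x)) a b := by
  rw [AbsolutelyContinuousOnInterval] at hg ⊢
  have h := hg.const_mul (K : ℝ)
  rw [mul_zero] at h
  refine squeeze_zero (fun _ => Finset.sum_nonneg fun _ _ => dist_nonneg) (fun E => ?_) h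
  rw [Finset.mul_sum]
  exact Finset.sum_le_sum fun i _ => hη.dist_le_mul _ _

theorem exists_ge_abs_lt_of_integrable {u : ℝ → ℝ} (hu : Integrable u) (N : ℝ) {r : ℝ}
    (hr : 0 < r) : ∃ x ≥ N, |u x| < r := by
  by_contra! h
  have h1 : IntegrableOn (fun _ : ℝ => r) (Ici N) := by
    refine Integrable.mono' (hu.abs.integrableOn) aestronglyMeasurable_const ?_
    filter_upwards [ae_restrict_mem measurableSet_Ici] with x hx
    rw [Real.norm_of_nonneg hr.le]
    exact h x hx
  rw [integrableOn_const_iff] at h1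
  simp [hr.ne'] at h1

/-- An integrable function need not vanish at infinity, but boundary terms only have to vanish along
some sequences. -/
theorem exists_seq_tendsto_zero_of_integrable {u : ℝ → ℝ} (hu : Integrable u) :
    ∃ a b : ℕ → ℝ, Tendsto a atTop atBot ∧ Tendsto b atTop atTop ∧
      Tendsto (fun n => u (a n)) atTop (𝓝 0) ∧ Tendsto (fun n => u (b n)) atTop (𝓝 0) := by
  have h1 := fun n : ℕ => exists_ge_abs_lt_of_integrable hu n (Nat.one_div_pos_of_nat (α := ℝ) (n := n))
  have h2 := fun n : ℕ => exists_ge_abs_lt_of_integrable hu.comp_neg n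
    (Nat.one_div_pos_of_nat (α := ℝ) (n := n))
  choose b hb hb' using h1
  choose a ha ha' using h2
  refine ⟨fun n => -a n, b, ?_, ?_, ?_, ?_⟩
  · exact tendsto_neg_atTop_atBot.comp
      (tendsto_atTop_mono ha tendsto_natCast_atTop_atTop)
  · exact tendsto_atTop_mono hb tendsto_natCast_atTop_atTop
  · exact squeeze_zero_norm (fun n => (ha' n).le) tendsto_one_div_add_atTop_nhds_zero_nat
  · exact squeeze_zero_norm (fun n => (hb' n).le) tendsto_one_div_add_atTop_nhds_zero_nat

theorem hasDerivAt_arctan_mul (n s : ℝ) :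
    HasDerivAt (fun s => Real.arctan (n * s)) (n / (1 + (n * s) ^ 2)) s := by
  have := ((hasDerivAt_id s).const_mul n).arctan
  simpa [div_eq_inv_mul] using this

theorem lipschitzWith_arctan_mul {n : ℝ} (hn : 0 ≤ n) :
    LipschitzWith n.toNNReal (fun s => Real.arctan (n * s)) := by
  refine lipschitzWith_of_nnnorm_deriv_le (fun s => (hasDerivAt_arctan_mul n s).differentiableAt)
    fun s => ?_
  rw [(hasDerivAt_arctan_mul n s).deriv, ← NNReal.coe_le_coe, coe_nnnorm, Real.coe_toNNReal _ hn,
    Real.norm_of_nonneg (by positivity)]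
  exact div_le_self hn (by nlinarith [sq_nonneg (n * s)])

theorem abs_arctan_le (s : ℝ) : |Real.arctan s| ≤ Real.pi / 2 :=
  abs_le.2 ⟨(Real.neg_pi_div_two_lt_arctan s).le, (Real.arctan_lt_pi_div_two s).le⟩

/-- The weight `s² η'(s)` for `η(s) = arctan (n s)`. -/
noncomputable def katoWeight (n s : ℝ) : ℝ := n * s ^ 2 / (1 + (n * s) ^ 2)

theorem katoWeight_nonneg {n : ℝ} (hn : 0 ≤ n) (s : ℝ) : 0 ≤ katoWeight n s := by
  rw [katoWeight]; positivity

/-- Follows from `n |s| ≤ 1 + (n s)²`. This bound supplies the dominating function, and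
`katoWeight_le_inv` the pointwise limit, when `n → ∞`. -/
theorem katoWeight_le_abs {n : ℝ} (hn : 0 ≤ n) (s : ℝ) : katoWeight n s ≤ |s| := by
  rw [katoWeight, div_le_iff₀ (by positivity), ← sq_abs s, mul_pow, ← sq_abs s]
  have := abs_nonneg s
  nlinarith [mul_nonneg this (sq_nonneg (n * |s| - 1)), mul_nonneg hn (mul_nonneg this this)]

theorem katoWeight_le_inv {n : ℝ} (hn : 0 < n) (s : ℝ) : katoWeight n s ≤ n⁻¹ := by
  rw [katoWeight, div_le_iff₀ (by positivity), inv_mul_eq_div, le_div_iff₀ hn]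
  nlinarith

theorem continuous_katoWeight (n : ℝ) : Continuous (katoWeight n) := by
  unfold katoWeight
  refine Continuous.div (by fun_prop) (by fun_prop) fun s => by positivity

theorem integrable_katoWeight {n : ℝ} (hn : 0 ≤ n) {u : ℝ → ℝ} (hu : Integrable u) :
    Integrable (fun x => katoWeight n (u x)) := by
  refine hu.abs.mono' ((continuous_katoWeight n).comp_aestronglyMeasurable hu.1)
    (Eventually.of_forall fun x => ?_)
  rw [Real.norm_of_nonneg (katoWeight_nonneg hn _)]
  exact katoWeight_le_abs hn _

theorem integrable_mul_arctan {v u : ℝ → ℝ} (hv : Integrable v) (hu : Integrable u) (n : ℝ) :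
    Integrable (fun x => v x * Real.arctan (n * u x)) := by
  refine hv.mul_bdd (c := Real.pi / 2) ?_ (Eventually.of_forall fun x => abs_arctan_le _)
  exact (Real.continuous_arctan.comp (continuous_const.mul continuous_id)).comp_aestronglyMeasurable
    hu.1

set_option maxHeartbeats 1000000 in
/-- An approximate form of Kato's inequality for the operator `u ↦ (h - ε u')'`, `|h| ≤ L |u|`. -/
theorem integral_mul_arctan_add_katoWeight_nonneg {u v h : ℝ → ℝ} {ε L : ℝ} (hε : 0 < ε)
    (hu : Integrable u) (hv : Integrable v) (hh : Integrable h)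
    (hL : ∀ᵐ x, |h x| ≤ L * |u x|)
    (hw : ∀ φ : ℝ → ℝ, ContDiff ℝ ∞ φ → HasCompactSupport φ →
      ∫ x, (-(h x * deriv φ x) - ε * u x * deriv (deriv φ) x) = ∫ x, v x * φ x)
    {n : ℝ} (hn : 0 < n) :
    0 ≤ ∫ x, (v x * Real.arctan (n * u x) + L ^ 2 / (4 * ε) * katoWeight n (u x)) := by
  set V : ℝ → ℝ := fun x => ∫ y in (0 : ℝ)..x, v y with hV
  have hVc : Continuous V := continuous_primitive' hv.locallyIntegrable
  have hp : LocallyIntegrable (fun x => V x - h x) volume :=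
    hVc.locallyIntegrable.sub hh.locallyIntegrable
  have hg : LocallyIntegrable (fun x => -(ε * u x)) volume := (hu.const_mul ε).neg.locallyIntegrable
  -- Writing `∫ v φ = -∫ V φ'` turns the equation into `∫ ((V - h) φ' - ε u φ'') = 0`.
  obtain ⟨c, d, hcd⟩ := exists_ae_eq_primitive hp hg (by
    intro φ hφ hφc
    have h1 := hw φ hφ hφc
    rw [integral_mul_eq_neg_integral_primitive_mul_deriv hv.locallyIntegrable
      (hφ.of_le (by simp)) hφc, ← add_eq_zero_iff_eq_neg, ← integral_add] at h1
    · rw [← h1]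
      congr 1
      ext x
      simp only [hV]
      ring
    · have i1 := hh.locallyIntegrable.integrable_mul_of_hasCompactSupport
        (contDiff_deriv_infty hφ).continuous hφc.deriv
      have i2 := (hu.const_mul ε).locallyIntegrable.integrable_mul_of_hasCompactSupport
        (contDiff_deriv_infty (contDiff_deriv_infty hφ)).continuous hφc.deriv.deriv
      exact i1.neg.sub i2
    · exact hVc.locallyIntegrable.integrable_mul_of_hasCompactSupport
        (contDiff_deriv_infty hφ).continuous hφc.deriv)
  have hpc : LocallyIntegrable (fun x => V x - h x - c) volume :=
    hp.sub (locallyIntegrable_const c)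
  -- The absolutely continuous representative of `u`; it satisfies `ε U' = h + W` almost everywhere
  -- with `W = c - V`.
  set U : ℝ → ℝ := fun x => -ε⁻¹ * (d + ∫ y in (0 : ℝ)..x, (V y - h y - c)) with hU
  have hUu : u =ᵐ[volume] U := by
    filter_upwards [hcd] with x hx
    simp only [hU, ← hx]
    field_simp
  have hUac : ∀ a b, AbsolutelyContinuousOnInterval U a b := fun a b =>
    (((LipschitzWith.const d).lipschitzOnWith.absolutelyContinuousOnInterval).fun_add
      (absolutelyContinuous_primitive hpc a b)).const_mul _
  set W : ℝ → ℝ := fun x => c - V x with hW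
  have hWac : ∀ a b, AbsolutelyContinuousOnInterval W a b := fun a b =>
    ((LipschitzWith.const c).lipschitzOnWith.absolutelyContinuousOnInterval).fun_sub
      (absolutelyContinuous_primitive hv.locallyIntegrable a b)
  have hUd : ∀ᵐ x, HasDerivAt U (ε⁻¹ * (h x + W x)) x := by
    filter_upwards [LocallyIntegrable.ae_hasDerivAt_integral hpc] with x hx
    have := ((hx 0).const_add d).const_mul (-ε⁻¹)
    convert! this using 1
    simp only [hW]
    ring
  have hWd : ∀ᵐ x, HasDerivAt W (-v x) x := by
    filter_upwards [LocallyIntegrable.ae_hasDerivAt_integral hv.locallyIntegrable] with x hx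
    exact (hx 0).const_sub c
  have hWb : ∀ x, |W x| ≤ |c| + ∫ y, |v y| := by
    intro x
    refine (abs_sub _ _).trans ?_
    gcongr
    have h1 := intervalIntegral.norm_integral_le_integral_norm_uIoc (f := v) (a := 0) (b := x)
      (μ := volume)
    refine h1.trans ?_
    exact setIntegral_le_integral hv.norm (Eventually.of_forall fun _ => norm_nonneg _)
  have hUi : Integrable U := hu.congr hUu
  have hgoal : ∫ x, (v x * Real.arctan (n * u x) + L ^ 2 / (4 * ε) * katoWeight n (u x))
      = ∫ x, (v x * Real.arctan (n * U x) + L ^ 2 / (4 * ε) * katoWeight n (U x)) := by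
    apply integral_congr_ae
    filter_upwards [hUu] with x hx
    rw [hx]
  rw [hgoal]
  have hI : Integrable
      (fun x => v x * Real.arctan (n * U x) + L ^ 2 / (4 * ε) * katoWeight n (U x)) :=
    (integrable_mul_arctan hv hUi n).add ((integrable_katoWeight hn.le hUi).const_mul _)
  set H : ℝ → ℝ := fun x => W x * Real.arctan (n * U x) with hH
  have hHac : ∀ a b, AbsolutelyContinuousOnInterval H a b := fun a b =>
    (hWac a b).fun_mul (AbsolutelyContinuousOnInterval.lipschitz_comp
      (η := fun s => Real.arctan (n * s)) (lipschitzWith_arctan_mul hn.le) (hUac a b))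
  have key : ∀ a b : ℝ, a ≤ b → H a - H b ≤
      ∫ x in a..b, (v x * Real.arctan (n * U x) + L ^ 2 / (4 * ε) * katoWeight n (U x)) := by
    intro a b hab
    rw [← neg_sub, ← (hHac a b).integral_deriv_eq_sub, ← intervalIntegral.integral_neg]
    refine intervalIntegral.integral_mono_ae hab (hHac a b).intervalIntegrable_deriv.neg
      hI.intervalIntegrable ?_
    filter_upwards [hUd, hWd, hL, hUu] with x hx1 hx2 hx3 hx4
    have hd : HasDerivAt H (-v x * Real.arctan (n * U x)
        + W x * (n / (1 + (n * U x) ^ 2) * (ε⁻¹ * (h x + W x)))) x :=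
      hx2.mul ((hasDerivAt_arctan_mul n (U x)).comp x hx1)
    rw [hd.deriv, katoWeight]
    have h0 : 0 ≤ n / (1 + (n * U x) ^ 2) := by positivity
    have h1 : h x ^ 2 ≤ L ^ 2 * U x ^ 2 := by
      rw [← sq_abs, ← sq_abs (U x), ← mul_pow]
      rw [hx4] at hx3
      gcongr
    -- Completing the square: `-W (h + W) = h² / 4 - (W + h / 2)² ≤ L² U² / 4`.
    have h2 : -(W x * (ε⁻¹ * (h x + W x))) ≤ L ^ 2 / (4 * ε) * U x ^ 2 := by
      have : L ^ 2 / (4 * ε) * U x ^ 2 + W x * (ε⁻¹ * (h x + W x))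
          = ε⁻¹ / 4 * ((L ^ 2 * U x ^ 2 - h x ^ 2) + (h x + 2 * W x) ^ 2) := by
        field_simp
        ring
      have : 0 ≤ ε⁻¹ / 4 * ((L ^ 2 * U x ^ 2 - h x ^ 2) + (h x + 2 * W x) ^ 2) := by
        have := sq_nonneg (h x + 2 * W x)
        have : 0 ≤ L ^ 2 * U x ^ 2 - h x ^ 2 := by linarith
        positivity
      linarith
    have h3 := mul_le_mul_of_nonneg_left h2 h0
    have e1 : n / (1 + (n * U x) ^ 2) * (L ^ 2 / (4 * ε) * U x ^ 2)
      = L ^ 2 / (4 * ε) * (n * U x ^ 2 / (1 + (n * U x) ^ 2)) := by ring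
    have e2 : n / (1 + (n * U x) ^ 2) * -(W x * (ε⁻¹ * (h x + W x)))
      = -(W x * (n / (1 + (n * U x) ^ 2) * (ε⁻¹ * (h x + W x)))) := by ring
    rw [e1, e2] at h3
    linarith
  -- Since `W` is bounded, `H` tends to `0` wherever `U` does, so both boundary terms disappear
  -- along these sequences.
  obtain ⟨a, b, ha, hb, hua, hub⟩ := exists_seq_tendsto_zero_of_integrable hUi
  have hlim : ∀ s : ℕ → ℝ, Tendsto (fun k => U (s k)) atTop (𝓝 0) →
      Tendsto (fun k => H (s k)) atTop (𝓝 0) := by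
    intro s hs
    have h1 : Tendsto (fun k => Real.arctan (n * U (s k))) atTop (𝓝 0) := by
      have := (Real.continuous_arctan.tendsto _).comp (hs.const_mul n)
      simpa [Function.comp_def] using this
    have h2 := h1.norm.const_mul (|c| + ∫ y, |v y|)
    rw [norm_zero, mul_zero] at h2
    refine squeeze_zero_norm (fun k => ?_) h2
    rw [hH, norm_mul]
    gcongr
    exact hWb _
  have hl := (hlim a hua).sub (hlim b hub)
  rw [sub_zero] at hl
  have hr := intervalIntegral_tendsto_integral hI ha hb
  refine le_of_tendsto_of_tendsto hl hr ?_
  filter_upwards [ha.eventually (eventually_le_atBot 0), hb.eventually (eventually_ge_atTop 0)]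
    with k h1 h2
  exact key _ _ (h1.trans h2)

/-- Let `n → ∞` in the arctangent inequality: `u arctan (n u)` tends to `(π / 2) |u|`, while
`|arctan| ≤ π / 2` bounds the other side, so the factor `π / 2` cancels. -/
theorem integral_abs_le_integral_abs_add {u v h : ℝ → ℝ} {ε L : ℝ} (hε : 0 < ε)
    (hu : Integrable u) (hv : Integrable v) (hh : Integrable h)
    (hL : ∀ᵐ x, |h x| ≤ L * |u x|)
    (hw : ∀ φ : ℝ → ℝ, ContDiff ℝ ∞ φ → HasCompactSupport φ →
      ∫ x, (-(h x * deriv φ x) - ε * u x * deriv (deriv φ) x) = ∫ x, v x * φ x)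
    {l : ℝ} (hl : 0 < l) : ∫ x, |u x| ≤ ∫ x, |u x + l * v x| := by
  have hpi := Real.pi_pos
  have hni : Tendsto (fun n : ℕ => ((n : ℝ) + 1)) atTop atTop :=
    tendsto_atTop_add_const_right _ _ tendsto_natCast_atTop_atTop
  have hpos : ∀ n : ℕ, (0 : ℝ) < n + 1 := fun n => by positivity
  have key : ∀ n : ℕ, ∫ x, u x * Real.arctan ((n + 1) * u x) ≤
      Real.pi / 2 * (∫ x, |u x + l * v x|)
        + l * (L ^ 2 / (4 * ε)) * ∫ x, katoWeight (n + 1) (u x) := by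
    intro n
    have h1 := integral_mul_arctan_add_katoWeight_nonneg hε hu hv hh hL hw (hpos n)
    have i1 := integrable_mul_arctan hv hu (n + 1)
    have i2 := integrable_mul_arctan hu hu (n + 1)
    have i3 := integrable_katoWeight (hpos n).le hu
    rw [integral_add i1 (i3.const_mul _), integral_const_mul] at h1
    have h2 : ∫ x, (u x + l * v x) * Real.arctan ((n + 1) * u x)
        ≤ ∫ x, Real.pi / 2 * |u x + l * v x| := by
      refine integral_mono (integrable_mul_arctan (hu.add (hv.const_mul l)) hu _)
        ((hu.add (hv.const_mul l)).abs.const_mul _) fun x => ?_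
      refine (le_abs_self _).trans ?_
      rw [abs_mul, mul_comm]
      gcongr
      exact abs_arctan_le _
    rw [integral_const_mul] at h2
    have h3 : ∫ x, (u x + l * v x) * Real.arctan ((n + 1) * u x)
        = (∫ x, u x * Real.arctan ((n + 1) * u x))
          + l * ∫ x, v x * Real.arctan ((n + 1) * u x) := by
      rw [← integral_const_mul, ← integral_add i2 (i1.const_mul l)]
      congr 1
      ext x
      ring
    nlinarith
  have lim1 : Tendsto (fun n : ℕ => ∫ x, u x * Real.arctan ((n + 1) * u x)) atTop
      (𝓝 (∫ x, Real.pi / 2 * |u x|)) := by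
    refine tendsto_integral_of_dominated_convergence (fun x => |u x| * (Real.pi / 2))
      (fun n => (integrable_mul_arctan hu hu _).1) (hu.abs.mul_const _) (fun n => ?_) ?_
    · refine Eventually.of_forall fun x => ?_
      rw [norm_mul]
      gcongr
      · exact le_rfl
      · exact abs_arctan_le _
    · refine Eventually.of_forall fun x => ?_
      rcases lt_trichotomy (u x) 0 with hx | hx | hx
      · have h1 : Tendsto (fun n : ℕ => ((n : ℝ) + 1) * u x) atTop atBot :=
          hni.atTop_mul_const_of_neg hx
        have h2 := (Real.tendsto_arctan_atBot.mono_right nhdsWithin_le_nhds).comp h1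
        have h3 := h2.const_mul (u x)
        rw [abs_of_neg hx]
        convert! h3 using 2
        ring
      · simp [hx]
      · have h1 : Tendsto (fun n : ℕ => ((n : ℝ) + 1) * u x) atTop atTop :=
          hni.atTop_mul_const hx
        have h2 := (Real.tendsto_arctan_atTop.mono_right nhdsWithin_le_nhds).comp h1
        have h3 := h2.const_mul (u x)
        rw [abs_of_pos hx]
        convert! h3 using 2
        ring
  have lim2 : Tendsto (fun n : ℕ => ∫ x, katoWeight (n + 1) (u x)) atTop (𝓝 0) := by
    have : (0 : ℝ) = ∫ _ : ℝ, (0 : ℝ) := by simp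
    rw [this]
    refine tendsto_integral_of_dominated_convergence (fun x => |u x|)
      (fun n => (integrable_katoWeight (hpos n).le hu).1) hu.abs (fun n => ?_) ?_
    · refine Eventually.of_forall fun x => ?_
      rw [Real.norm_of_nonneg (katoWeight_nonneg (hpos n).le _)]
      exact katoWeight_le_abs (hpos n).le _
    · refine Eventually.of_forall fun x => ?_
      exact squeeze_zero (fun n => katoWeight_nonneg (hpos n).le _)
        (fun n => katoWeight_le_inv (hpos n) _) (tendsto_inv_atTop_zero.comp hni)
  have h := le_of_tendsto_of_tendsto' lim1
    ((lim2.const_mul (l * (L ^ 2 / (4 * ε)))).const_add _) key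
  rw [integral_const_mul, mul_zero, add_zero] at h
  exact le_of_mul_le_mul_left h (by positivity)

end Regularity

/-! ### The superposition operator and accretivity -/

section Nemytskii

variable {f : ℝ → ℝ → ℝ}

theorem FluxHyp.continuous (hf : FluxHyp f) (x : ℝ) : Continuous (f x) := (hf.smooth x).continuous

/-- Off a null set of `x`, the flux agrees with a jointly measurable function. -/
theorem FluxHyp.exists_measurable (hf : FluxHyp f) :
    ∃ g : ℝ → ℝ → ℝ, Measurable (fun p : ℝ × ℝ => g p.1 p.2) ∧ ∀ᵐ x, ∀ w, f x w = g x w := by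
  have hm : ∀ q : ℚ, AEStronglyMeasurable (fun x => f x q) volume := fun q => (hf.bounded q).1
  set m : ℚ → ℝ → ℝ := fun q => (hm q).mk with hmdef
  have hae : ∀ᵐ x, ∀ q : ℚ, f x q = m q x := ae_all_iff.2 fun q => (hm q).ae_eq_mk
  -- Measurable representatives are chosen for rational `w` only, so the exceptional set is null.
  -- Setting `g = 0` on it keeps `g` continuous in `w`, and measurability in `x` at real `w` follows
  -- by limits.
  set S := toMeasurable volume {x | ¬ ∀ q : ℚ, f x q = m q x} with hS
  have hS0 : volume S = 0 := by rw [hS, measure_toMeasurable]; exact hae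
  have hSm : MeasurableSet S := measurableSet_toMeasurable _ _
  set g : ℝ → ℝ → ℝ := fun x w => Sᶜ.indicator (fun x => f x w) x with hg
  have hgq : ∀ q : ℚ, Measurable fun x => g x q := by
    intro q
    have : (fun x => g x q) = Sᶜ.indicator (m q) := by
      ext x
      simp only [hg]
      by_cases hx : x ∈ S
      · simp [hx]
      · have hx' : ∀ q : ℚ, f x q = m q x := by
          by_contra h
          exact hx (subset_toMeasurable _ _ h)
        simp [hx, hx' q]
    rw [this]
    exact (hm q).stronglyMeasurable_mk.measurable.indicator hSm.compl
  have hgc : ∀ x, Continuous (g x) := by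
    intro x
    by_cases hx : x ∈ S
    · have : g x = fun _ => 0 := by ext w; simp [hg, hx]
      rw [this]; exact continuous_const
    · have : g x = f x := by ext w; simp [hg, hx]
      rw [this]; exact hf.continuous x
  have hgw : ∀ w : ℝ, Measurable fun x => g x w := by
    intro w
    obtain ⟨q, -, -, hq⟩ := Real.exists_seq_rat_strictMono_tendsto w
    exact measurable_of_tendsto_metrizable (fun n => hgq (q n))
      (tendsto_pi_nhds.2 fun x => ((hgc x).tendsto w).comp hq)
  refine ⟨g, ?_, ?_⟩
  · have := measurable_uncurry_of_continuous_of_measurable (u := fun w x => g x w) hgc hgw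
    exact this.comp measurable_swap
  · have : ∀ᵐ x, x ∉ S := measure_eq_zero_iff_ae_notMem.1 hS0
    filter_upwards [this] with x hx w
    simp [hg, hx]

theorem FluxHyp.integrable_zero (hf : FluxHyp f) : Integrable (fun x => f x 0) := by
  obtain ⟨L₁, -, h⟩ := hf.integrable
  refine ⟨(hf.bounded 0).1, ?_⟩
  rw [hasFiniteIntegral_iff_norm]
  exact h.trans_lt ENNReal.ofReal_lt_top

theorem FluxHyp.integrable_comp (hf : FluxHyp f) {u : ℝ → ℝ} (hu : Integrable u) :
    Integrable (fun x => f x (u x)) := by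
  obtain ⟨L, hL0, hL⟩ := hf.lipschitz
  obtain ⟨g, hg, hfg⟩ := hf.exists_measurable
  refine (hf.integrable_zero.abs.add (hu.abs.const_mul L)).mono' ?_ ?_
  · have h1 : AEMeasurable (fun x => g x (u x)) volume :=
      hg.comp_aemeasurable (aemeasurable_id.prodMk hu.1.aemeasurable)
    refine (h1.congr ?_).aestronglyMeasurable
    filter_upwards [hfg] with x hx
    exact (hx _).symm
  · refine Eventually.of_forall fun x => ?_
    have h := hL x (u x) 0
    rw [sub_zero] at h
    rw [Real.norm_eq_abs]
    have := abs_sub_abs_le_abs_sub (f x (u x)) (f x 0)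
    simp only [Pi.add_apply]
    linarith

theorem integrable_coeFn (u : ℝ →₁[volume] ℝ) : Integrable (u : ℝ → ℝ) := L1.integrable_coeFn u

/-- The superposition operator `u ↦ f (·, u(·))` on `L¹`. -/
noncomputable def nemytskii (hf : FluxHyp f) (u : ℝ →₁[volume] ℝ) : ℝ →₁[volume] ℝ :=
  (hf.integrable_comp (integrable_coeFn u)).toL1 _

theorem coeFn_nemytskii (hf : FluxHyp f) (u : ℝ →₁[volume] ℝ) :
    nemytskii hf u =ᵐ[volume] fun x => f x (u x) := Integrable.coeFn_toL1 _

theorem norm_L1_eq (u : ℝ →₁[volume] ℝ) : ‖u‖ = ∫ x, |u x| := by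
  rw [L1.norm_eq_integral_norm]; rfl

theorem norm_L1_sub_eq (u v : ℝ →₁[volume] ℝ) : ‖u - v‖ = ∫ x, |u x - v x| := by
  rw [norm_L1_eq]
  apply integral_congr_ae
  filter_upwards [Lp.coeFn_sub u v] with x hx
  rw [hx, Pi.sub_apply]

theorem norm_nemytskii_sub_le (hf : FluxHyp f) {L : ℝ}
    (hL : ∀ x w₁ w₂ : ℝ, |f x w₁ - f x w₂| ≤ L * |w₁ - w₂|) (u v : ℝ →₁[volume] ℝ) :
    ‖nemytskii hf u - nemytskii hf v‖ ≤ L * ‖u - v‖ := by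
  rw [norm_L1_sub_eq, norm_L1_sub_eq, ← integral_const_mul]
  refine integral_mono_ae ((integrable_coeFn _).sub (integrable_coeFn _)).abs
    (((integrable_coeFn _).sub (integrable_coeFn _)).abs.const_mul _) ?_
  filter_upwards [coeFn_nemytskii hf u, coeFn_nemytskii hf v] with x h1 h2
  simp only [h1, h2]
  exact hL _ _ _

theorem integrable_mul_of_compactSupport {u φ : ℝ → ℝ} (hu : Integrable u) (hφ : Continuous φ)
    (hc : HasCompactSupport φ) : Integrable (fun x => u x * φ x) :=
  hu.locallyIntegrable.integrable_mul_of_hasCompactSupport hφ hc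

theorem contDiff_one_deriv {φ : ℝ → ℝ} (hφ : ContDiff ℝ 2 φ) : ContDiff ℝ 1 (deriv φ) := by
  have : ContDiff ℝ (1 + 1) φ := hφ
  exact (contDiff_succ_iff_deriv.1 this).2.2

theorem continuous_deriv_deriv {φ : ℝ → ℝ} (hφ : ContDiff ℝ 2 φ) : Continuous (deriv (deriv φ)) :=
  (contDiff_one_deriv hφ).continuous_deriv le_rfl

theorem integrable_viscous_integrand (hf : FluxHyp f) (ε : ℝ) {u φ : ℝ → ℝ} (hu : Integrable u)
    (hφ : ContDiff ℝ 2 φ) (hc : HasCompactSupport φ) :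
    Integrable (fun x => -(f x (u x) * deriv φ x) - ε * u x * deriv (deriv φ) x) :=
  (integrable_mul_of_compactSupport (hf.integrable_comp hu) (contDiff_one_deriv hφ).continuous
    hc.deriv).neg.sub (integrable_mul_of_compactSupport (hu.const_mul ε) (continuous_deriv_deriv hφ)
    hc.deriv.deriv)

theorem mem_viscousOperator_iff (hf : FluxHyp f) {ε : ℝ} {u v : ℝ →₁[volume] ℝ} :
    (u, v) ∈ viscousOperator f ε ↔ ∀ φ : ℝ → ℝ, ContDiff ℝ 2 φ → HasCompactSupport φ →
      ∫ x : ℝ, (-(f x (u x) * deriv φ x) - ε * u x * deriv (deriv φ) x) = ∫ x : ℝ, v x * φ x :=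
  ⟨fun h => h.2, fun h => ⟨(hf.integrable_comp (integrable_coeFn u)).locallyIntegrable, h⟩⟩

/-- The difference of two solutions solves the equation of the Kato estimate with `h = f(x, u₁) -
f(x, u₂)`, and the Lipschitz bound on `f` gives `|h| ≤ L |u₁ - u₂|`. -/
theorem isAccretive_viscousOperator (hf : FluxHyp f) {ε : ℝ} (hε : 0 < ε) :
    IsAccretive (viscousOperator f ε) := by
  obtain ⟨L, -, hL⟩ := hf.lipschitz
  intro u₁ v₁ u₂ v₂ h₁ h₂ l hl
  rw [mem_viscousOperator_iff hf] at h₁ h₂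
  have hu₁ := integrable_coeFn u₁
  have hu₂ := integrable_coeFn u₂
  have hv₁ := integrable_coeFn v₁
  have hv₂ := integrable_coeFn v₂
  have key := integral_abs_le_integral_abs_add (u := fun x => u₁ x - u₂ x)
    (v := fun x => v₁ x - v₂ x) (h := fun x => f x (u₁ x) - f x (u₂ x)) hε (hu₁.sub hu₂)
    (hv₁.sub hv₂) ((hf.integrable_comp hu₁).sub (hf.integrable_comp hu₂))
    (Eventually.of_forall fun x => hL x _ _) (by
      intro φ hφ hc
      have hφ2 : ContDiff ℝ 2 φ := by exact_mod_cast contDiff_infty.1 hφ 2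
      have e1 := h₁ φ hφ2 hc
      have e2 := h₂ φ hφ2 hc
      have e3 : ∫ x, (v₁ x - v₂ x) * φ x = (∫ x, v₁ x * φ x) - ∫ x, v₂ x * φ x := by
        rw [← integral_sub (integrable_mul_of_compactSupport hv₁ hφ.continuous hc)
          (integrable_mul_of_compactSupport hv₂ hφ.continuous hc)]
        congr 1
        ext x
        ring
      rw [e3, ← e1, ← e2, ← integral_sub (integrable_viscous_integrand hf ε hu₁ hφ2 hc)
        (integrable_viscous_integrand hf ε hu₂ hφ2 hc)]
      congr 1
      ext x
      ring) hl
  rw [norm_L1_sub_eq, norm_L1_sub_eq]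
  refine key.trans (le_of_eq (integral_congr_ae ?_))
  filter_upwards [Lp.coeFn_add u₁ (l • v₁), Lp.coeFn_add u₂ (l • v₂), Lp.coeFn_smul l v₁,
    Lp.coeFn_smul l v₂] with x a1 a2 a3 a4
  simp only [a1, a2, Pi.add_apply, a3, a4, Pi.smul_apply, smul_eq_mul]
  congr 1
  ring

end Nemytskii

/-! ### Convolution operators on `L¹` -/

section Convolution

theorem integrable_convolution_prod {k w : ℝ → ℝ} (hk : Integrable k) (hw : Integrable w) :
    Integrable (fun p : ℝ × ℝ => w p.2 * k (p.1 - p.2)) (volume.prod volume) :=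
  hw.convolution_integrand (ContinuousLinearMap.mul ℝ ℝ) hk

theorem integral_abs_convolution_le {k w : ℝ → ℝ} (hk : Integrable k) (hw : Integrable w) :
    ∫ x, |∫ y, w y * k (x - y)| ≤ (∫ z, |k z|) * ∫ y, |w y| := by
  have hI := integrable_convolution_prod hk hw
  calc ∫ x, |∫ y, w y * k (x - y)| ≤ ∫ x, ∫ y, |w y * k (x - y)| := by
        refine integral_mono hI.integral_prod_left.abs hI.abs.integral_prod_left fun x => ?_
        exact abs_integral_le_integral_abs
    _ = ∫ y, ∫ x, |w y * k (x - y)| := integral_integral_swap hI.abs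
    _ = ∫ y, |w y| * ∫ z, |k z| := by
        congr 1
        ext y
        simp_rw [abs_mul]
        rw [integral_const_mul, integral_sub_right_eq_self (fun z => |k z|)]
    _ = _ := by rw [integral_mul_const, mul_comm]

/-- Convolution with an integrable kernel as a bounded operator on `L¹`. -/
noncomputable def convL1 (k : ℝ → ℝ) (hk : Integrable k) :
    (ℝ →₁[volume] ℝ) →L[ℝ] (ℝ →₁[volume] ℝ) :=
  LinearMap.mkContinuous
    { toFun := fun w => (integrable_convolution_prod hk (integrable_coeFn w)).integral_prod_left.toL1 _
      map_add' := by
        intro w₁ w₂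
        rw [← Integrable.toL1_add]
        refine (Integrable.toL1_eq_toL1_iff _ _ _ _).2 ?_
        filter_upwards [(integrable_convolution_prod hk (integrable_coeFn w₁)).prod_right_ae,
          (integrable_convolution_prod hk (integrable_coeFn w₂)).prod_right_ae] with x h1 h2
        simp only [Pi.add_apply]
        rw [← integral_add h1 h2]
        apply integral_congr_ae
        filter_upwards [Lp.coeFn_add w₁ w₂] with y hy
        rw [hy, Pi.add_apply, add_mul]
      map_smul' := by
        intro c w
        rw [RingHom.id_apply, ← Integrable.toL1_smul]
        refine (Integrable.toL1_eq_toL1_iff _ _ _ _).2 (Eventually.of_forall fun x => ?_)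
        simp only [smul_eq_mul, ← integral_const_mul]
        apply integral_congr_ae
        filter_upwards [Lp.coeFn_smul c w] with y hy
        rw [hy, Pi.smul_apply, smul_eq_mul, mul_assoc] }
    (∫ z, |k z|) (by
      intro w
      rw [norm_L1_eq, norm_L1_eq]
      refine le_trans (le_of_eq (integral_congr_ae ?_))
        (integral_abs_convolution_le hk (integrable_coeFn w))
      filter_upwards [Integrable.coeFn_toL1
        (integrable_convolution_prod hk (integrable_coeFn w)).integral_prod_left] with x hx
      exact congrArg abs hx)

theorem coeFn_convL1 {k : ℝ → ℝ} (hk : Integrable k) (w : ℝ →₁[volume] ℝ) :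
    convL1 k hk w =ᵐ[volume] fun x => ∫ y, w y * k (x - y) :=
  Integrable.coeFn_toL1 (integrable_convolution_prod hk (integrable_coeFn w)).integral_prod_left

theorem norm_convL1_le {k : ℝ → ℝ} (hk : Integrable k) (w : ℝ →₁[volume] ℝ) :
    ‖convL1 k hk w‖ ≤ (∫ z, |k z|) * ‖w‖ :=
  (convL1 k hk).le_of_opNorm_le (LinearMap.mkContinuous_norm_le _
    (integral_nonneg fun _ => abs_nonneg _) _) w

/-- Fubini transfers the kernel to the test function, so operator identities reduce to identities
for the kernel against `C²_c` functions. -/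
theorem integral_convL1_mul {k ψ : ℝ → ℝ} (hk : Integrable k) (w : ℝ →₁[volume] ℝ)
    (hψ : Continuous ψ) (hc : HasCompactSupport ψ) :
    ∫ x, convL1 k hk w x * ψ x = ∫ y, w y * ∫ x, k (x - y) * ψ x := by
  have hI := integrable_convolution_prod hk (integrable_coeFn w)
  obtain ⟨C, hC⟩ := hψ.bounded_above_of_compact_support hc
  have hI2 : Integrable (fun p : ℝ × ℝ => w p.2 * k (p.1 - p.2) * ψ p.1) (volume.prod volume) :=
    hI.mul_bdd (c := C) (hψ.comp continuous_fst).aestronglyMeasurable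
      (Eventually.of_forall fun p => hC _)
  calc ∫ x, convL1 k hk w x * ψ x = ∫ x, ∫ y, w y * k (x - y) * ψ x := by
        apply integral_congr_ae
        filter_upwards [coeFn_convL1 hk w] with x hx
        rw [hx, integral_mul_const]
    _ = ∫ y, ∫ x, w y * k (x - y) * ψ x := integral_integral_swap hI2
    _ = _ := by
        congr 1
        ext y
        rw [← integral_const_mul]
        congr 1
        ext x
        ring

end Convolution

/-! ### The Green operator of `1 - a² ∂²` and its derivative -/

section Green

/-- The one-sided exponential kernel. -/
noncomputable def expKernel (a z : ℝ) : ℝ := (Ioi (0 : ℝ)).indicator (fun z => Real.exp (-z / a)) z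

theorem integrable_expKernel {a : ℝ} (ha : 0 < a) : Integrable (expKernel a) := by
  have h := integrableOn_exp_mul_Ioi (a := -a⁻¹) (by simpa using ha) 0
  have h2 := (integrable_indicator_iff measurableSet_Ioi).2 h
  refine h2.congr (Eventually.of_forall fun z => ?_)
  simp only [expKernel]
  congr 1
  ext z
  congr 1
  ring

theorem integral_abs_expKernel {a : ℝ} (ha : 0 < a) : ∫ z, |expKernel a z| = a := by
  have h : ∀ z, |expKernel a z| = (Ioi (0 : ℝ)).indicator (fun z => Real.exp (-a⁻¹ * z)) z := by
    intro z
    rw [expKernel, abs_of_nonneg (indicator_nonneg (fun _ _ => (Real.exp_pos _).le) _)]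
    congr 1
    ext z
    congr 1
    ring
  simp_rw [h]
  rw [integral_indicator measurableSet_Ioi, integral_exp_mul_Ioi (by simpa using ha)]
  field_simp
  simp

/-- The integrand on the half-line is the derivative of `-exp(-z/a) (a φ + a² φ')`, so only the
boundary value at `0` survives. With the mirrored kernel the sign of `φ'` flips: sums isolate `φ`,
differences isolate `φ'`. -/
theorem integral_expKernel_mul_zero {a : ℝ} (ha : 0 < a) {φ : ℝ → ℝ} (hφ : ContDiff ℝ 2 φ)
    (hc : HasCompactSupport φ) :
    ∫ z, expKernel a z * (φ z - a ^ 2 * deriv (deriv φ) z) = a * φ 0 + a ^ 2 * deriv φ 0 := by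
  set Ψ : ℝ → ℝ := fun z => -(Real.exp (-z / a) * (a * φ z + a ^ 2 * deriv φ z)) with hΨ
  have hd1 := contDiff_one_deriv hφ
  have hΨc : HasCompactSupport Ψ :=
    HasCompactSupport.neg (HasCompactSupport.mul_left (hc.mul_left.add hc.deriv.mul_left))
  have hΨ1 : ContDiff ℝ 1 Ψ := by
    refine ContDiff.neg (ContDiff.mul ?_ (ContDiff.add ?_ ?_))
    · exact Real.contDiff_exp.comp (contDiff_neg.div_const _)
    · exact contDiff_const.mul (hφ.of_le (by norm_num))
    · exact contDiff_const.mul hd1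
  have hder : ∀ z, deriv Ψ z = Real.exp (-z / a) * (φ z - a ^ 2 * deriv (deriv φ) z) := by
    intro z
    have h1 : HasDerivAt φ (deriv φ z) z := (hφ.differentiable (by norm_num) z).hasDerivAt
    have h2 : HasDerivAt (deriv φ) (deriv (deriv φ) z) z :=
      (hd1.differentiable (by norm_num) z).hasDerivAt
    have h3 : HasDerivAt (fun z => Real.exp (-z / a)) (Real.exp (-z / a) * (-1 / a)) z :=
      ((hasDerivAt_neg z).div_const a).exp
    have h4 := (h3.mul ((h1.const_mul a).add (h2.const_mul (a ^ 2)))).neg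
    have h5 : deriv Ψ z = _ := h4.deriv
    rw [h5]
    simp only [Pi.add_apply]
    field_simp
    ring
  have h := HasCompactSupport.integral_Ioi_deriv_eq hΨ1 hΨc 0
  simp_rw [hder] at h
  rw [← integral_indicator measurableSet_Ioi] at h
  have e : Ψ 0 = -(a * φ 0 + a ^ 2 * deriv φ 0) := by simp [hΨ]
  rw [e, neg_neg] at h
  rw [← h]
  congr 1
  ext z
  by_cases hz : z ∈ Ioi (0 : ℝ) <;> simp [expKernel, hz]

theorem integral_expKernel_mul {a : ℝ} (ha : 0 < a) {φ : ℝ → ℝ} (hφ : ContDiff ℝ 2 φ)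
    (hc : HasCompactSupport φ) (y : ℝ) :
    ∫ x, expKernel a (x - y) * (φ x - a ^ 2 * deriv (deriv φ) x) = a * φ y + a ^ 2 * deriv φ y := by
  have h := integral_expKernel_mul_zero ha (φ := fun z => φ (z + y))
    (hφ.comp (contDiff_id.add contDiff_const))
    (hc.comp_homeomorph (Homeomorph.addRight y))
  have e1 : deriv (fun z => φ (z + y)) = fun z => deriv φ (z + y) := by
    ext z; exact deriv_comp_add_const _ _ _
  have e2 : deriv (fun z => deriv φ (z + y)) = fun z => deriv (deriv φ) (z + y) := by
    ext z; exact deriv_comp_add_const _ _ _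
  rw [e1, e2] at h
  simp only [zero_add] at h
  rw [← h, ← integral_sub_right_eq_self
    (fun z => expKernel a z * (φ (z + y) - a ^ 2 * deriv (deriv φ) (z + y))) y]
  simp

theorem integral_expKernel_neg_mul {a : ℝ} (ha : 0 < a) {φ : ℝ → ℝ} (hφ : ContDiff ℝ 2 φ)
    (hc : HasCompactSupport φ) (y : ℝ) :
    ∫ x, expKernel a (y - x) * (φ x - a ^ 2 * deriv (deriv φ) x) = a * φ y - a ^ 2 * deriv φ y := by
  have h := integral_expKernel_mul ha (φ := fun z => φ (-z))
    (hφ.comp contDiff_neg) (hc.comp_homeomorph (Homeomorph.neg ℝ)) (-y)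
  have e1 : deriv (fun z => φ (-z)) = fun z => -deriv φ (-z) := by
    ext z; exact deriv_comp_neg _ _
  have e2 : deriv (fun z => -deriv φ (-z)) = fun z => deriv (deriv φ) (-z) := by
    ext z
    rw [deriv.fun_neg, deriv_comp_neg, neg_neg]
  rw [e1, e2, ← integral_neg_eq_self] at h
  simp only [neg_neg, sub_neg_eq_add] at h
  rw [sub_eq_add_neg, ← mul_neg, ← h]
  congr 1
  ext x
  congr 2
  ring

variable (a : ℝ) (ha : 0 < a)

/-- The resolvent `(1 - a² ∂²)⁻¹` on `L¹`. -/
noncomputable def greenL1 : (ℝ →₁[volume] ℝ) →L[ℝ] (ℝ →₁[volume] ℝ) :=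
  (2 * a)⁻¹ • (convL1 (expKernel a) (integrable_expKernel ha)
    + convL1 (fun z => expKernel a (-z)) (integrable_expKernel ha).comp_neg)

/-- The operator `∂ (1 - a² ∂²)⁻¹` on `L¹`. -/
noncomputable def greenDerivL1 : (ℝ →₁[volume] ℝ) →L[ℝ] (ℝ →₁[volume] ℝ) :=
  (2 * a ^ 2)⁻¹ • (convL1 (fun z => expKernel a (-z)) (integrable_expKernel ha).comp_neg
    - convL1 (expKernel a) (integrable_expKernel ha))

theorem norm_convL1_expKernel_le (w : ℝ →₁[volume] ℝ) :
    ‖convL1 (expKernel a) (integrable_expKernel ha) w‖ ≤ a * ‖w‖ := by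
  have := norm_convL1_le (integrable_expKernel ha) w
  rwa [integral_abs_expKernel ha] at this

theorem norm_convL1_expKernel_neg_le (w : ℝ →₁[volume] ℝ) :
    ‖convL1 (fun z => expKernel a (-z)) (integrable_expKernel ha).comp_neg w‖ ≤ a * ‖w‖ := by
  have := norm_convL1_le (integrable_expKernel ha).comp_neg w
  rwa [integral_neg_eq_self (fun z => |expKernel a z|), integral_abs_expKernel ha] at this

theorem norm_greenL1_le (w : ℝ →₁[volume] ℝ) : ‖greenL1 a ha w‖ ≤ ‖w‖ := by
  have h1 := norm_convL1_expKernel_le a ha w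
  have h2 := norm_convL1_expKernel_neg_le a ha w
  rw [greenL1, _root_.smul_apply, norm_smul, Real.norm_of_nonneg (by positivity),
    _root_.add_apply, inv_mul_le_iff₀ (by positivity)]
  exact (norm_add_le _ _).trans (by linarith)

theorem norm_greenDerivL1_le (w : ℝ →₁[volume] ℝ) : ‖greenDerivL1 a ha w‖ ≤ a⁻¹ * ‖w‖ := by
  have h1 := norm_convL1_expKernel_le a ha w
  have h2 := norm_convL1_expKernel_neg_le a ha w
  rw [greenDerivL1, _root_.smul_apply, norm_smul, Real.norm_of_nonneg (by positivity),
    _root_.sub_apply, inv_mul_le_iff₀ (by positivity)]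
  refine (norm_sub_le _ _).trans ?_
  have : 2 * a ^ 2 * (a⁻¹ * ‖w‖) = a * ‖w‖ + a * ‖w‖ := by field_simp; ring
  linarith

theorem continuous_helmholtz {φ : ℝ → ℝ} (hφ : ContDiff ℝ 2 φ) :
    Continuous (fun x => φ x - a ^ 2 * deriv (deriv φ) x) :=
  hφ.continuous.sub (continuous_const.mul (continuous_deriv_deriv hφ))

theorem hasCompactSupport_helmholtz {φ : ℝ → ℝ} (hc : HasCompactSupport φ) :
    HasCompactSupport (fun x => φ x - a ^ 2 * deriv (deriv φ) x) :=
  hc.sub hc.deriv.deriv.mul_left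

theorem integral_convL1_expKernel_mul (w : ℝ →₁[volume] ℝ) {φ : ℝ → ℝ} (hφ : ContDiff ℝ 2 φ)
    (hc : HasCompactSupport φ) :
    ∫ x, convL1 (expKernel a) (integrable_expKernel ha) w x * (φ x - a ^ 2 * deriv (deriv φ) x)
      = a * (∫ x, w x * φ x) + a ^ 2 * ∫ x, w x * deriv φ x := by
  rw [integral_convL1_mul _ _ (continuous_helmholtz a hφ) (hasCompactSupport_helmholtz a hc)]
  simp_rw [integral_expKernel_mul ha hφ hc]
  rw [← integral_const_mul, ← integral_const_mul, ← integral_add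
    ((integrable_mul_of_compactSupport (integrable_coeFn w) hφ.continuous hc).const_mul a)
    ((integrable_mul_of_compactSupport (integrable_coeFn w) (contDiff_one_deriv hφ).continuous
      hc.deriv).const_mul _)]
  congr 1
  ext x
  ring

theorem integral_convL1_expKernel_neg_mul (w : ℝ →₁[volume] ℝ) {φ : ℝ → ℝ}
    (hφ : ContDiff ℝ 2 φ) (hc : HasCompactSupport φ) :
    ∫ x, convL1 (fun z => expKernel a (-z)) (integrable_expKernel ha).comp_neg w x
        * (φ x - a ^ 2 * deriv (deriv φ) x)
      = a * (∫ x, w x * φ x) - a ^ 2 * ∫ x, w x * deriv φ x := by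
  rw [integral_convL1_mul _ _ (continuous_helmholtz a hφ) (hasCompactSupport_helmholtz a hc)]
  simp_rw [neg_sub, integral_expKernel_neg_mul ha hφ hc]
  rw [← integral_const_mul, ← integral_const_mul, ← integral_sub
    ((integrable_mul_of_compactSupport (integrable_coeFn w) hφ.continuous hc).const_mul a)
    ((integrable_mul_of_compactSupport (integrable_coeFn w) (contDiff_one_deriv hφ).continuous
      hc.deriv).const_mul _)]
  congr 1
  ext x
  ring

theorem integrable_coeFn_mul_helmholtz (w : ℝ →₁[volume] ℝ) {φ : ℝ → ℝ} (hφ : ContDiff ℝ 2 φ)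
    (hc : HasCompactSupport φ) :
    Integrable (fun x => w x * (φ x - a ^ 2 * deriv (deriv φ) x)) :=
  integrable_mul_of_compactSupport (integrable_coeFn w) (continuous_helmholtz a hφ)
    (hasCompactSupport_helmholtz a hc)

theorem integral_greenL1_mul (w : ℝ →₁[volume] ℝ) {φ : ℝ → ℝ} (hφ : ContDiff ℝ 2 φ)
    (hc : HasCompactSupport φ) :
    ∫ x, greenL1 a ha w x * (φ x - a ^ 2 * deriv (deriv φ) x) = ∫ x, w x * φ x := by
  set w₁ := convL1 (expKernel a) (integrable_expKernel ha) w with hw₁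
  set w₂ := convL1 (fun z => expKernel a (-z)) (integrable_expKernel ha).comp_neg w with hw₂
  have e : ∫ x, greenL1 a ha w x * (φ x - a ^ 2 * deriv (deriv φ) x)
      = (2 * a)⁻¹ * ((∫ x, w₁ x * (φ x - a ^ 2 * deriv (deriv φ) x))
        + ∫ x, w₂ x * (φ x - a ^ 2 * deriv (deriv φ) x)) := by
    rw [← integral_add (integrable_coeFn_mul_helmholtz a w₁ hφ hc)
      (integrable_coeFn_mul_helmholtz a w₂ hφ hc), ← integral_const_mul]
    apply integral_congr_ae
    filter_upwards [Lp.coeFn_smul (2 * a)⁻¹ (w₁ + w₂), Lp.coeFn_add w₁ w₂] with x h1 h2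
    have : greenL1 a ha w = (2 * a)⁻¹ • (w₁ + w₂) := rfl
    rw [this, h1, Pi.smul_apply, h2, Pi.add_apply, smul_eq_mul]
    ring
  rw [e, integral_convL1_expKernel_mul a ha w hφ hc, integral_convL1_expKernel_neg_mul a ha w hφ hc]
  field_simp
  ring

theorem integral_greenDerivL1_mul (w : ℝ →₁[volume] ℝ) {φ : ℝ → ℝ} (hφ : ContDiff ℝ 2 φ)
    (hc : HasCompactSupport φ) :
    ∫ x, greenDerivL1 a ha w x * (φ x - a ^ 2 * deriv (deriv φ) x) = -∫ x, w x * deriv φ x := by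
  set w₁ := convL1 (expKernel a) (integrable_expKernel ha) w with hw₁
  set w₂ := convL1 (fun z => expKernel a (-z)) (integrable_expKernel ha).comp_neg w with hw₂
  have e : ∫ x, greenDerivL1 a ha w x * (φ x - a ^ 2 * deriv (deriv φ) x)
      = (2 * a ^ 2)⁻¹ * ((∫ x, w₂ x * (φ x - a ^ 2 * deriv (deriv φ) x))
        - ∫ x, w₁ x * (φ x - a ^ 2 * deriv (deriv φ) x)) := by
    rw [← integral_sub (integrable_coeFn_mul_helmholtz a w₂ hφ hc)
      (integrable_coeFn_mul_helmholtz a w₁ hφ hc), ← integral_const_mul]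
    apply integral_congr_ae
    filter_upwards [Lp.coeFn_smul (2 * a ^ 2)⁻¹ (w₂ - w₁), Lp.coeFn_sub w₂ w₁] with x h1 h2
    have : greenDerivL1 a ha w = (2 * a ^ 2)⁻¹ • (w₂ - w₁) := rfl
    rw [this, h1, Pi.smul_apply, h2, Pi.sub_apply, smul_eq_mul]
    ring
  rw [e, integral_convL1_expKernel_mul a ha w hφ hc, integral_convL1_expKernel_neg_mul a ha w hφ hc]
  field_simp
  ring

theorem greenL1_helmholtz {φ : ℝ → ℝ} (hφ : ContDiff ℝ 2 φ) (hc : HasCompactSupport φ)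
    {w : ℝ →₁[volume] ℝ} (hw : w =ᵐ[volume] fun x => φ x - a ^ 2 * deriv (deriv φ) x) :
    greenL1 a ha w =ᵐ[volume] φ := by
  set w₁ := convL1 (expKernel a) (integrable_expKernel ha) w with hw₁
  set w₂ := convL1 (fun z => expKernel a (-z)) (integrable_expKernel ha).comp_neg w with hw₂
  have : greenL1 a ha w = (2 * a)⁻¹ • (w₁ + w₂) := rfl
  rw [this]
  filter_upwards [Lp.coeFn_smul (2 * a)⁻¹ (w₁ + w₂), Lp.coeFn_add w₁ w₂,
    coeFn_convL1 (integrable_expKernel ha) w,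
    coeFn_convL1 (integrable_expKernel ha).comp_neg w] with x h1 h2 h3 h4
  rw [h1, Pi.smul_apply, h2, Pi.add_apply, smul_eq_mul, h3, h4]
  have e1 : ∫ y, w y * expKernel a (x - y) = a * φ x - a ^ 2 * deriv φ x := by
    rw [← integral_expKernel_neg_mul ha hφ hc x]
    apply integral_congr_ae
    filter_upwards [hw] with y hy
    rw [hy, mul_comm]
  have e2 : ∫ y, w y * expKernel a (-(x - y)) = a * φ x + a ^ 2 * deriv φ x := by
    rw [← integral_expKernel_mul ha hφ hc x]
    apply integral_congr_ae
    filter_upwards [hw] with y hy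
    rw [hy, mul_comm, neg_sub]
  rw [e1, e2]
  field_simp
  ring

/-- Since `w = G (w - a² φ'')`, the difference `G w - w` is `a² G φ''`, and `G` is a contraction. -/
theorem norm_greenL1_sub_le {φ : ℝ → ℝ} (hφ : ContDiff ℝ 2 φ) (hc : HasCompactSupport φ)
    {w : ℝ →₁[volume] ℝ} (hw : w =ᵐ[volume] φ) :
    ‖greenL1 a ha w - w‖ ≤ a ^ 2 * ∫ x, |deriv (deriv φ) x| := by
  have hi : Integrable (deriv (deriv φ)) :=
    (continuous_deriv_deriv hφ).integrable_of_hasCompactSupport hc.deriv.deriv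
  have h1 : greenL1 a ha (w - a ^ 2 • hi.toL1 _) = w := by
    refine Lp.ext ((greenL1_helmholtz a ha hφ hc ?_).trans hw.symm)
    filter_upwards [Lp.coeFn_sub w (a ^ 2 • hi.toL1 _), Lp.coeFn_smul (a ^ 2) (hi.toL1 _),
      Integrable.coeFn_toL1 hi, hw] with x h1 h2 h3 h4
    rw [h1, Pi.sub_apply, h2, Pi.smul_apply, h3, h4, smul_eq_mul]
  rw [map_sub, sub_eq_iff_eq_add] at h1
  rw [h1, add_sub_cancel_left]
  refine (norm_greenL1_le a ha _).trans (le_of_eq ?_)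
  rw [norm_smul, Real.norm_of_nonneg (by positivity), norm_L1_eq]
  congr 1
  apply integral_congr_ae
  filter_upwards [Integrable.coeFn_toL1 hi] with x hx
  rw [hx]

end Green

/-! ### The range condition and density of the domain -/

section Resolvent

variable {f : ℝ → ℝ → ℝ}

/-- The map whose fixed points solve `u + l A u = w`. -/
noncomputable def resolventMap (hf : FluxHyp f) (a : ℝ) (ha : 0 < a) (l : ℝ) (w u : ℝ →₁[volume] ℝ) :
    ℝ →₁[volume] ℝ :=
  greenL1 a ha w - l • greenDerivL1 a ha (nemytskii hf u)

theorem norm_resolventMap_sub_le (hf : FluxHyp f) {L : ℝ}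
    (hL : ∀ x w₁ w₂ : ℝ, |f x w₁ - f x w₂| ≤ L * |w₁ - w₂|) {a : ℝ} (ha : 0 < a) {l : ℝ}
    (hl : 0 ≤ l) (w u₁ u₂ : ℝ →₁[volume] ℝ) :
    ‖resolventMap hf a ha l w u₁ - resolventMap hf a ha l w u₂‖ ≤ l * a⁻¹ * L * ‖u₁ - u₂‖ := by
  rw [resolventMap, resolventMap, sub_sub_sub_cancel_left, ← smul_sub, ← map_sub, norm_smul,
    Real.norm_of_nonneg hl, norm_sub_rev u₁ u₂]
  have h1 := norm_greenDerivL1_le a ha (nemytskii hf u₂ - nemytskii hf u₁)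
  have h2 := norm_nemytskii_sub_le hf hL u₂ u₁
  calc _ ≤ l * (a⁻¹ * (L * ‖u₂ - u₁‖)) := by
        gcongr
        exact h1.trans (by gcongr)
    _ = _ := by ring

theorem integral_viscous_integrand (hf : FluxHyp f) (ε : ℝ) {u φ : ℝ → ℝ} (hu : Integrable u)
    (hφ : ContDiff ℝ 2 φ) (hc : HasCompactSupport φ) :
    ∫ x, (-(f x (u x) * deriv φ x) - ε * u x * deriv (deriv φ) x)
      = -(∫ x, f x (u x) * deriv φ x) - ε * ∫ x, u x * deriv (deriv φ) x := by
  have i1 : Integrable (fun x => -(f x (u x) * deriv φ x)) :=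
    (integrable_mul_of_compactSupport (hf.integrable_comp hu) (contDiff_one_deriv hφ).continuous
      hc.deriv).neg
  have i2 := (integrable_mul_of_compactSupport hu (continuous_deriv_deriv hφ)
    hc.deriv.deriv).const_mul ε
  rw [← integral_neg, ← integral_const_mul, ← integral_sub i1 i2]
  congr 1
  ext x
  ring

/-- Testing the fixed-point identity against `φ - a² φ''` undoes both Green operators and leaves `∫
u φ - l ε ∫ u φ'' = ∫ w φ + l ∫ f(x, u) φ'`, the weak form of `u + l A u = w`. -/
theorem mem_viscousOperator_of_fixed (hf : FluxHyp f) {ε l a : ℝ} (ha : 0 < a) (hl : 0 < l)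
    (hal : a ^ 2 = l * ε) {w u : ℝ →₁[volume] ℝ} (hu : resolventMap hf a ha l w u = u) :
    (u, l⁻¹ • (w - u)) ∈ viscousOperator f ε := by
  rw [mem_viscousOperator_iff hf]
  intro φ hφ hc
  have iu := integrable_coeFn u
  have iw := integrable_coeFn w
  have ifu := hf.integrable_comp iu
  have hd := (contDiff_one_deriv hφ).continuous
  have hdd := continuous_deriv_deriv hφ
  have e1 : ∫ x, u x * (φ x - a ^ 2 * deriv (deriv φ) x)
      = (∫ x, w x * φ x) + l * ∫ x, f x (u x) * deriv φ x := by
    have h1 : ∫ x, u x * (φ x - a ^ 2 * deriv (deriv φ) x)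
        = (∫ x, greenL1 a ha w x * (φ x - a ^ 2 * deriv (deriv φ) x))
        - l * ∫ x, greenDerivL1 a ha (nemytskii hf u) x * (φ x - a ^ 2 * deriv (deriv φ) x) := by
      rw [← integral_const_mul, ← integral_sub (integrable_coeFn_mul_helmholtz a _ hφ hc)
        ((integrable_coeFn_mul_helmholtz a _ hφ hc).const_mul l)]
      apply integral_congr_ae
      filter_upwards [Lp.coeFn_sub (greenL1 a ha w) (l • greenDerivL1 a ha (nemytskii hf u)),
        Lp.coeFn_smul l (greenDerivL1 a ha (nemytskii hf u))] with x h1 h2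
      have h3 : u x = (resolventMap hf a ha l w u) x := by rw [hu]
      rw [h3, resolventMap, h1, Pi.sub_apply, h2, Pi.smul_apply, smul_eq_mul]
      ring
    rw [h1, integral_greenL1_mul a ha w hφ hc, integral_greenDerivL1_mul a ha _ hφ hc]
    have : ∫ x, nemytskii hf u x * deriv φ x = ∫ x, f x (u x) * deriv φ x := by
      apply integral_congr_ae
      filter_upwards [coeFn_nemytskii hf u] with x hx
      rw [hx]
    rw [this]
    ring
  have e2 : ∫ x, u x * (φ x - a ^ 2 * deriv (deriv φ) x)
      = (∫ x, u x * φ x) - l * ε * ∫ x, u x * deriv (deriv φ) x := by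
    rw [← integral_const_mul, ← integral_sub (integrable_mul_of_compactSupport iu hφ.continuous hc)
      ((integrable_mul_of_compactSupport iu hdd hc.deriv.deriv).const_mul _), hal]
    congr 1
    ext x
    ring
  have e3 : ∫ x, (l⁻¹ • (w - u) : ℝ →₁[volume] ℝ) x * φ x
      = l⁻¹ * ((∫ x, w x * φ x) - ∫ x, u x * φ x) := by
    rw [← integral_sub (integrable_mul_of_compactSupport iw hφ.continuous hc)
      (integrable_mul_of_compactSupport iu hφ.continuous hc), ← integral_const_mul]
    apply integral_congr_ae
    filter_upwards [Lp.coeFn_smul l⁻¹ (w - u), Lp.coeFn_sub w u] with x h1 h2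
    rw [h1, Pi.smul_apply, h2, Pi.sub_apply, smul_eq_mul]
    ring
  rw [e3, integral_viscous_integrand hf ε iu hφ hc]
  field_simp
  linarith

theorem mem_backwardEuler_of_fixed (hf : FluxHyp f) {ε l a : ℝ} (ha : 0 < a) (hl : 0 < l)
    (hal : a ^ 2 = l * ε) {w u : ℝ →₁[volume] ℝ} (hu : resolventMap hf a ha l w u = u) :
    (w, u) ∈ backwardEuler (viscousOperator f ε) l :=
  ⟨_, mem_viscousOperator_of_fixed hf ha hl hal hu, by
    rw [smul_inv_smul₀ hl.ne', add_sub_cancel]⟩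

theorem exists_fixed_of_le_half (hf : FluxHyp f) {L : ℝ}
    (hL : ∀ x w₁ w₂ : ℝ, |f x w₁ - f x w₂| ≤ L * |w₁ - w₂|) {a : ℝ} (ha : 0 < a) {l : ℝ}
    (hl : 0 ≤ l) (h : l * a⁻¹ * L ≤ 1 / 2) (w : ℝ →₁[volume] ℝ) :
    ∃ u, resolventMap hf a ha l w u = u := by
  have hc : ContractingWith (1 / 2 : ℝ≥0) (resolventMap hf a ha l w) := by
    refine ⟨by
      rw [← NNReal.coe_lt_coe]
      norm_num, LipschitzWith.of_dist_le_mul fun u₁ u₂ => ?_⟩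
    rw [dist_eq_norm, dist_eq_norm]
    refine (norm_resolventMap_sub_le hf hL ha hl w u₁ u₂).trans ?_
    push_cast
    gcongr
  exact ⟨_, hc.fixedPoint_isFixedPt⟩

/-- The left side is `L √(l / ε)`, at most `L / (2 (L + 1))`. Using `L + 1` keeps the threshold
meaningful when `L = 0`. -/
theorem step_bound {ε l L : ℝ} (hε : 0 < ε) (hl : 0 < l) (hL : 0 ≤ L)
    (h : l ≤ ε / (4 * (L + 1) ^ 2)) : l * (√(l * ε))⁻¹ * L ≤ 1 / 2 := by
  have hs : 0 < √(l * ε) := Real.sqrt_pos.2 (by positivity)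
  rw [mul_right_comm, ← div_eq_mul_inv, div_le_iff₀ hs]
  rw [← div_le_iff₀' (by norm_num)]
  apply Real.le_sqrt_of_sq_le
  rw [le_div_iff₀ (by positivity)] at h
  have : l * (4 * L ^ 2) ≤ ε := by nlinarith
  nlinarith

theorem hasFullRange_viscousOperator (hf : FluxHyp f) {ε L : ℝ} (hε : 0 < ε) (hL0 : 0 ≤ L)
    (hL : ∀ x w₁ w₂ : ℝ, |f x w₁ - f x w₂| ≤ L * |w₁ - w₂|) :
    HasFullRange (viscousOperator f ε) (ε / (4 * (L + 1) ^ 2)) := by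
  intro l hl hl₀ w
  have ha : 0 < √(l * ε) := Real.sqrt_pos.2 (by positivity)
  obtain ⟨u, hu⟩ := exists_fixed_of_le_half hf hL ha hl.le (step_bound hε hl hL0 hl₀) w
  exact ⟨u, mem_backwardEuler_of_fixed hf ha hl (Real.sq_sqrt (by positivity)) hu⟩

/-- Test functions are dense, and such a `w` is the limit of resolvent solutions as `l → 0`: the
fixed-point map moves `w` by at most `l ε ∫ |φ''| + √(l / ε) ‖f(·, w)‖`, and the contraction factor
`1/2` doubles this at most. -/
theorem closure_domain_viscousOperator (hf : FluxHyp f) {ε : ℝ} (hε : 0 < ε) :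
    closure (domain (viscousOperator f ε)) = univ := by
  obtain ⟨L, hL0, hL⟩ := hf.lipschitz
  have hdense := Lp.dense_hasCompactSupport_contDiff (E := ℝ) (F := ℝ) (μ := volume) (p := 1)
    (by simp)
  refine eq_univ_of_univ_subset ?_
  rw [← hdense.closure_eq]
  refine closure_minimal ?_ isClosed_closure
  rintro w ⟨φ, hw, hc, hφ⟩
  have hφ2 : ContDiff ℝ 2 φ := by exact_mod_cast contDiff_infty.1 hφ 2
  set C := ∫ x, |deriv (deriv φ) x|
  set M := ‖nemytskii hf w‖
  have hlim : Tendsto (fun l : ℝ => 2 * (l * ε * C + √(l / ε) * M)) (𝓝[>] 0) (𝓝 0) := by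
    have : Continuous (fun l : ℝ => 2 * (l * ε * C + √(l / ε) * M)) := by fun_prop
    have h := this.tendsto 0
    simp only [zero_mul, zero_div, Real.sqrt_zero, add_zero, mul_zero] at h
    exact h.mono_left nhdsWithin_le_nhds
  rw [Metric.mem_closure_iff]
  intro r hr
  have hmem : ∀ᶠ l in 𝓝[>] (0 : ℝ), 0 < l ∧ l ≤ ε / (4 * (L + 1) ^ 2) :=
    Ioc_mem_nhdsGT (by positivity)
  obtain ⟨l, hlr, hl, hl₀⟩ := ((hlim.eventually_lt_const hr).and hmem).exists
  have ha : 0 < √(l * ε) := Real.sqrt_pos.2 (by positivity)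
  have hsq : √(l * ε) ^ 2 = l * ε := Real.sq_sqrt (by positivity)
  have hb := step_bound hε hl hL0 hl₀
  obtain ⟨u, hu⟩ := exists_fixed_of_le_half hf hL ha hl.le hb w
  refine ⟨u, ⟨_, mem_viscousOperator_of_fixed hf ha hl hsq hu⟩, ?_⟩
  have h1 : ‖u - w‖ ≤ 1 / 2 * ‖u - w‖ + (l * ε * C + √(l / ε) * M) := by
    have e : u - w = (resolventMap hf _ ha l w u - resolventMap hf _ ha l w w)
        + ((greenL1 _ ha w - w) - l • greenDerivL1 _ ha (nemytskii hf w)) := by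
      rw [hu]
      simp only [resolventMap]
      abel
    have h2 := norm_resolventMap_sub_le hf hL ha hl.le w u w
    have h3 := norm_greenL1_sub_le _ ha hφ2 hc hw
    have h4 : ‖l • greenDerivL1 _ ha (nemytskii hf w)‖ ≤ √(l / ε) * M := by
      rw [norm_smul, Real.norm_of_nonneg hl.le]
      refine (mul_le_mul_of_nonneg_left (norm_greenDerivL1_le _ ha _) hl.le).trans (le_of_eq ?_)
      rw [← mul_assoc, Real.sqrt_mul hl.le, Real.sqrt_div hl.le]
      congr 1
      have := Real.mul_self_sqrt hl.le
      have := Real.sqrt_pos.2 hl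
      have := Real.sqrt_pos.2 hε
      field_simp
      linarith
    rw [hsq] at h3
    calc ‖u - w‖ ≤ ‖resolventMap hf _ ha l w u - resolventMap hf _ ha l w w‖
          + (‖greenL1 _ ha w - w‖ + ‖l • greenDerivL1 _ ha (nemytskii hf w)‖) := by
          conv_lhs => rw [e]
          exact (norm_add_le _ _).trans (by gcongr; exact norm_sub_le _ _)
      _ ≤ 1 / 2 * ‖u - w‖ + (l * ε * C + √(l / ε) * M) := by
          gcongr
          exact h2.trans (by gcongr)
  rw [dist_comm, dist_eq_norm]
  linarith

end Resolvent

/-! ### Short-time expansion of the semigroup in weak form -/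

section ShortTime

variable {f : ℝ → ℝ → ℝ}

/-- The weak form of `-[f (x, u) - ε u_x]_x` tested against `ψ`. -/
noncomputable def weakForm (f : ℝ → ℝ → ℝ) (ε : ℝ) (u : ℝ →₁[volume] ℝ) (ψ : ℝ → ℝ) : ℝ :=
  (∫ x, f x (u x) * deriv ψ x) + ε * ∫ x, u x * deriv (deriv ψ) x

theorem integral_mul_sub_integral_mul {u₁ u₂ ψ : ℝ → ℝ} (h₁ : Integrable u₁) (h₂ : Integrable u₂)
    (hψ : Continuous ψ) (hc : HasCompactSupport ψ) :
    (∫ x, u₁ x * ψ x) - ∫ x, u₂ x * ψ x = ∫ x, (u₁ x - u₂ x) * ψ x := by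
  rw [← integral_sub (integrable_mul_of_compactSupport h₁ hψ hc)
    (integrable_mul_of_compactSupport h₂ hψ hc)]
  congr 1
  ext x
  ring

theorem abs_integral_mul_le {u ψ : ℝ → ℝ} (hu : Integrable u) {M : ℝ} (hM : ∀ x, |ψ x| ≤ M) :
    |∫ x, u x * ψ x| ≤ M * ∫ x, |u x| := by
  rw [← integral_const_mul]
  refine (Real.norm_eq_abs _).symm.le.trans (norm_integral_le_of_norm_le (hu.abs.const_mul M) <|
    Eventually.of_forall fun x => ?_)
  rw [Real.norm_eq_abs, abs_mul, mul_comm]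
  gcongr
  exact hM x

theorem integral_J_mul_sub (hf : FluxHyp f) {ε l₀ : ℝ} (hR : HasFullRange (viscousOperator f ε) l₀)
    {l : ℝ} (hl : 0 < l) (hl₀ : l ≤ l₀) (w : ℝ →₁[volume] ℝ) {ψ : ℝ → ℝ} (hψ : ContDiff ℝ 2 ψ)
    (hc : HasCompactSupport ψ) :
    (∫ x, J (viscousOperator f ε) l w x * ψ x) - ∫ x, w x * ψ x
      = l * weakForm f ε (J (viscousOperator f ε) l w) ψ := by
  have h := (mem_viscousOperator_iff hf).1 (J_mem hR hl hl₀ w) ψ hψ hc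
  set u := J (viscousOperator f ε) l w
  rw [integral_viscous_integrand hf ε (integrable_coeFn u) hψ hc] at h
  have e : ∫ x, (l⁻¹ • (w - u) : ℝ →₁[volume] ℝ) x * ψ x
      = l⁻¹ * ((∫ x, w x * ψ x) - ∫ x, u x * ψ x) := by
    rw [integral_mul_sub_integral_mul (integrable_coeFn w) (integrable_coeFn u) hψ.continuous hc,
      ← integral_const_mul]
    apply integral_congr_ae
    filter_upwards [Lp.coeFn_smul l⁻¹ (w - u), Lp.coeFn_sub w u] with x h1 h2
    rw [h1, Pi.smul_apply, h2, Pi.sub_apply, smul_eq_mul]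
    ring
  rw [e] at h
  field_simp at h
  rw [weakForm]
  linarith

theorem exists_weakForm_lipschitz (hf : FluxHyp f) {ε : ℝ} (hε : 0 < ε) {ψ : ℝ → ℝ}
    (hψ : ContDiff ℝ 2 ψ) (hc : HasCompactSupport ψ) :
    ∃ C : ℝ, 0 ≤ C ∧ ∀ u w : ℝ →₁[volume] ℝ,
      |weakForm f ε u ψ - weakForm f ε w ψ| ≤ C * ‖u - w‖ := by
  obtain ⟨L, hL0, hL⟩ := hf.lipschitz
  have hd := (contDiff_one_deriv hψ).continuous
  have hdd := continuous_deriv_deriv hψ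
  obtain ⟨M₁, hM₁⟩ := hd.bounded_above_of_compact_support hc.deriv
  obtain ⟨M₂, hM₂⟩ := hdd.bounded_above_of_compact_support hc.deriv.deriv
  have hM₁0 : 0 ≤ M₁ := (norm_nonneg _).trans (hM₁ 0)
  have hM₂0 : 0 ≤ M₂ := (norm_nonneg _).trans (hM₂ 0)
  refine ⟨M₁ * L + ε * M₂, by positivity, fun u w => ?_⟩
  have iu := integrable_coeFn u
  have iw := integrable_coeFn w
  have ifu := hf.integrable_comp iu
  have ifw := hf.integrable_comp iw
  have e : weakForm f ε u ψ - weakForm f ε w ψ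
      = (∫ x, (f x (u x) - f x (w x)) * deriv ψ x)
        + ε * ∫ x, (u x - w x) * deriv (deriv ψ) x := by
    rw [← integral_mul_sub_integral_mul ifu ifw hd hc.deriv,
      ← integral_mul_sub_integral_mul iu iw hdd hc.deriv.deriv, weakForm, weakForm]
    ring
  have h1 := abs_integral_mul_le (ifu.sub ifw) hM₁
  have h2 := abs_integral_mul_le (iu.sub iw) hM₂
  simp only [Pi.sub_apply] at h1 h2
  have h3 : ∫ x, |f x (u x) - f x (w x)| ≤ L * ∫ x, |u x - w x| := by
    rw [← integral_const_mul]
    exact integral_mono (ifu.sub ifw).abs ((iu.sub iw).abs.const_mul L) fun x => hL _ _ _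
  rw [e, norm_L1_sub_eq]
  refine (abs_add_le _ _).trans ?_
  rw [abs_mul, abs_of_pos hε]
  have h4 := mul_le_mul_of_nonneg_left h3 hM₁0
  have h5 := mul_le_mul_of_nonneg_left h2 hε.le
  linarith

/-- The tested Euler steps telescope into `l` times weak forms at successive iterates, all close to
`w`. Since `w` may lie outside the domain, closeness is measured through a domain point `u`. -/
theorem abs_integral_iterate_J_sub_le (hf : FluxHyp f) {ε l₀ : ℝ} (hε : 0 < ε)
    (hR : HasFullRange (viscousOperator f ε) l₀) {u v w : ℝ →₁[volume] ℝ}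
    (huv : (u, v) ∈ viscousOperator f ε) {ψ : ℝ → ℝ} (hψ : ContDiff ℝ 2 ψ)
    (hc : HasCompactSupport ψ) {C : ℝ} (hC0 : 0 ≤ C)
    (hC : ∀ u w : ℝ →₁[volume] ℝ, |weakForm f ε u ψ - weakForm f ε w ψ| ≤ C * ‖u - w‖)
    {l : ℝ} (hl : 0 < l) (hl₀ : l ≤ l₀) (n : ℕ) :
    |(∫ x, (J (viscousOperator f ε) l)^[n] w x * ψ x) - (∫ x, w x * ψ x)
        - n * l * weakForm f ε w ψ|
      ≤ n * l * (C * (2 * ‖w - u‖ + n * l * ‖v‖)) := by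
  have hA := isAccretive_viscousOperator hf hε
  induction n with
  | zero => simp
  | succ n ih =>
    rw [Function.iterate_succ_apply']
    set z := (J (viscousOperator f ε) l)^[n] w with hz
    have h1 := integral_J_mul_sub hf hR hl hl₀ z hψ hc
    have h2 := norm_iterate_J_sub_self_le_of_approx hA hR hl hl₀ huv (n + 1) w
    rw [Function.iterate_succ_apply', ← hz] at h2
    have h3 := hC (J (viscousOperator f ε) l z) w
    have h4 : |weakForm f ε (J (viscousOperator f ε) l z) ψ - weakForm f ε w ψ|
        ≤ C * (2 * ‖w - u‖ + (n + 1 : ℕ) * l * ‖v‖) := h3.trans (by gcongr)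
    have e : (∫ x, J (viscousOperator f ε) l z x * ψ x) - (∫ x, w x * ψ x)
        - (n + 1 : ℕ) * l * weakForm f ε w ψ
        = ((∫ x, z x * ψ x) - (∫ x, w x * ψ x) - n * l * weakForm f ε w ψ)
          + l * (weakForm f ε (J (viscousOperator f ε) l z) ψ - weakForm f ε w ψ) := by
      push_cast
      linarith
    rw [e]
    refine (abs_add_le _ _).trans ?_
    rw [abs_mul, abs_of_pos hl]
    have h5 : n * l * (C * (2 * ‖w - u‖ + n * l * ‖v‖))
        ≤ n * l * (C * (2 * ‖w - u‖ + (n + 1 : ℕ) * l * ‖v‖)) := by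
      gcongr
      simp
    have h6 := mul_le_mul_of_nonneg_left h4 hl.le
    have h7 : ((n + 1 : ℕ) : ℝ) = n + 1 := by push_cast; rfl
    rw [h7] at h5 h6 ⊢
    linarith

theorem continuous_integral_mul {ψ : ℝ → ℝ} (hψ : Continuous ψ) (hc : HasCompactSupport ψ) :
    Continuous (fun w : ℝ →₁[volume] ℝ => ∫ x, w x * ψ x) := by
  obtain ⟨M, hM⟩ := hψ.bounded_above_of_compact_support hc
  have hM0 : 0 ≤ M := (norm_nonneg _).trans (hM 0)
  refine (LipschitzWith.of_dist_le_mul (K := ⟨M, hM0⟩) fun u w => ?_).continuous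
  rw [Real.dist_eq, integral_mul_sub_integral_mul (integrable_coeFn u) (integrable_coeFn w) hψ hc,
    dist_eq_norm, norm_L1_sub_eq]
  exact abs_integral_mul_le ((integrable_coeFn u).sub (integrable_coeFn w)) hM

theorem abs_integral_semigroup_sub_le (hf : FluxHyp f) {ε l₀ : ℝ} (hε : 0 < ε)
    (hR : HasFullRange (viscousOperator f ε) l₀) (h₀ : 0 < l₀) {u v w : ℝ →₁[volume] ℝ}
    (huv : (u, v) ∈ viscousOperator f ε) {ψ : ℝ → ℝ} (hψ : ContDiff ℝ 2 ψ)
    (hc : HasCompactSupport ψ) {C : ℝ} (hC0 : 0 ≤ C)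
    (hC : ∀ u w : ℝ →₁[volume] ℝ, |weakForm f ε u ψ - weakForm f ε w ψ| ≤ C * ‖u - w‖) (t : ℝ≥0) :
    |(∫ x, semigroup (viscousOperator f ε) t w x * ψ x) - (∫ x, w x * ψ x)
        - t * weakForm f ε w ψ|
      ≤ t * (C * (2 * ‖w - u‖ + t * ‖v‖)) := by
  have : (eulerFilter (t : ℝ)).NeBot := eulerFilter_neBot t.2
  have hlim := tendsto_iterate_J (isAccretive_viscousOperator hf hε) hR h₀
    (closure_domain_viscousOperator hf hε) t w
  have hT := tendsto_time_eulerFilter (t : ℝ)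
  have h1 := (((continuous_integral_mul hψ.continuous hc).tendsto _).comp hlim)
  have h2 := ((h1.sub_const (∫ x, w x * ψ x)).sub (hT.mul_const (weakForm f ε w ψ))).abs
  have h3 := hT.mul (((hT.mul_const ‖v‖).const_add (2 * ‖w - u‖)).const_mul C)
  refine le_of_tendsto_of_tendsto h2 h3 ?_
  filter_upwards [eventually_eulerFilter_step h₀] with p hp
  exact abs_integral_iterate_J_sub_le hf hε hR huv hψ hc hC0 hC hp.1 hp.2 p.2

/-- The semigroup law restarts the evolution at time `t`, so the expansion at time `0` yields the
derivative from the right. -/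
theorem hasDerivWithinAt_integral_semigroup (hf : FluxHyp f) {ε l₀ : ℝ} (hε : 0 < ε)
    (hR : HasFullRange (viscousOperator f ε) l₀) (h₀ : 0 < l₀) (w : ℝ →₁[volume] ℝ)
    {ψ : ℝ → ℝ} (hψ : ContDiff ℝ 2 ψ) (hc : HasCompactSupport ψ) {t : ℝ} (ht : 0 ≤ t) :
    HasDerivWithinAt (fun s : ℝ => ∫ x, semigroup (viscousOperator f ε) s.toNNReal w x * ψ x)
      (weakForm f ε (semigroup (viscousOperator f ε) t.toNNReal w) ψ) (Ioi t) t := by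
  have hA := isAccretive_viscousOperator hf hε
  have hd := closure_domain_viscousOperator hf hε
  obtain ⟨C, hC0, hC⟩ := exists_weakForm_lipschitz hf hε hψ hc
  set z := semigroup (viscousOperator f ε) t.toNNReal w with hz
  rw [hasDerivWithinAt_iff_isLittleO, Asymptotics.isLittleO_iff]
  intro r hr
  -- The domain point `u` is fixed first, then the time window depending on `‖v‖`: each error term
  -- contributes at most `r / (2 (C + 1))`.
  obtain ⟨u, ⟨v, huv⟩, hu⟩ := Metric.mem_closure_iff.1
    (hd ▸ mem_univ z : z ∈ closure (domain (viscousOperator f ε))) (r / (4 * (C + 1)))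
    (by positivity)
  rw [dist_eq_norm] at hu
  have hη : 0 < r / (2 * (C + 1) * (‖v‖ + 1)) := by positivity
  filter_upwards [Ioo_mem_nhdsGT (show t < t + r / (2 * (C + 1) * (‖v‖ + 1)) by linarith)]
    with s hs
  have hst : 0 ≤ s - t := by linarith [hs.1]
  have hsum : semigroup (viscousOperator f ε) s.toNNReal w
      = semigroup (viscousOperator f ε) (s - t).toNNReal z := by
    rw [hz, semigroup_semigroup hA hR h₀ hd, ← Real.toNNReal_add hst ht, sub_add_cancel]
  have h := abs_integral_semigroup_sub_le hf hε hR h₀ huv (w := z) hψ hc hC0 hC (s - t).toNNReal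
  rw [Real.coe_toNNReal _ hst] at h
  rw [hsum, smul_eq_mul, Real.norm_eq_abs, Real.norm_of_nonneg hst]
  refine h.trans ?_
  rw [mul_comm]
  gcongr
  have h1 : 2 * ‖z - u‖ ≤ r / (2 * (C + 1)) := by
    have : r / (2 * (C + 1)) = 2 * (r / (4 * (C + 1))) := by field_simp; norm_num
    linarith
  have h2 : (s - t) * ‖v‖ ≤ r / (2 * (C + 1)) := by
    have : r / (2 * (C + 1)) = r / (2 * (C + 1) * (‖v‖ + 1)) * (‖v‖ + 1) := by field_simp
    rw [this]
    gcongr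
    · linarith [hs.2]
    · linarith
  calc C * (2 * ‖z - u‖ + (s - t) * ‖v‖) ≤ (C + 1) * (r / (2 * (C + 1)) + r / (2 * (C + 1))) := by
        gcongr
        linarith
    _ = r := by field_simp; ring

end ShortTime

/-! ### Jointly measurable representatives -/

section Representative

/-- A jointly measurable representative of a curve in `L¹(ℝ)`. -/
noncomputable def representative (c : ℝ → (ℝ →₁[volume] ℝ)) (t x : ℝ) : ℝ :=
  deriv (fun x => ∫ y in (0 : ℝ)..x, c t y) x

theorem representative_ae_eq (c : ℝ → (ℝ →₁[volume] ℝ)) (t : ℝ) :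
    representative c t =ᵐ[volume] c t := by
  filter_upwards [LocallyIntegrable.ae_hasDerivAt_integral (integrable_coeFn (c t)).locallyIntegrable]
    with x hx
  exact (hx 0).deriv

/-- The `L¹` distance bounds the difference of primitives uniformly in `x`. Joint continuity is what
makes the `x`-derivative jointly measurable. -/
theorem continuous_primitive_curve {c : ℝ → (ℝ →₁[volume] ℝ)} (hc : Continuous c) :
    Continuous (Function.uncurry fun t x : ℝ => ∫ y in (0 : ℝ)..x, c t y) := by
  rw [continuous_iff_continuousAt]
  rintro ⟨t, x⟩
  have h1 : Tendsto (fun p : ℝ × ℝ => ∫ y in (0 : ℝ)..p.2, c t y) (𝓝 (t, x))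
      (𝓝 (∫ y in (0 : ℝ)..x, c t y)) :=
    ((continuous_primitive' (integrable_coeFn (c t)).locallyIntegrable).comp
      continuous_snd).tendsto _
  refine h1.congr_dist ?_
  have h2 : Tendsto (fun p : ℝ × ℝ => ‖c t - c p.1‖) (𝓝 (t, x)) (𝓝 0) := by
    have : Continuous (fun p : ℝ × ℝ => ‖c t - c p.1‖) := by fun_prop
    have := this.tendsto (t, x)
    simpa using this
  refine squeeze_zero (fun _ => dist_nonneg) (fun p => ?_) h2
  simp only [Function.uncurry]
  rw [Real.dist_eq, norm_L1_sub_eq, ← intervalIntegral.integral_sub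
    (integrable_coeFn _).intervalIntegrable (integrable_coeFn _).intervalIntegrable]
  have i := (integrable_coeFn (c t)).sub (integrable_coeFn (c p.1))
  have h3 := intervalIntegral.norm_integral_le_integral_norm_uIoc (f := fun y => c t y - c p.1 y)
    (a := 0) (b := p.2) (μ := volume)
  exact h3.trans (setIntegral_le_integral i.norm (Eventually.of_forall fun _ => norm_nonneg _))

theorem measurable_representative {c : ℝ → (ℝ →₁[volume] ℝ)} (hc : Continuous c) :
    Measurable (fun p : ℝ × ℝ => representative c p.1 p.2) :=
  measurable_deriv_with_param (continuous_primitive_curve hc)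

theorem locallyIntegrable_of_curve {c : ℝ → (ℝ →₁[volume] ℝ)} (hc : Continuous c)
    {u : ℝ → ℝ → ℝ} (hu : AEStronglyMeasurable (fun p : ℝ × ℝ => u p.1 p.2) volume)
    (h : ∀ t, u t =ᵐ[volume] c t) : LocallyIntegrable (fun p : ℝ × ℝ => u p.1 p.2) volume := by
  rintro ⟨t, x⟩
  refine ⟨Icc (t - 1) (t + 1) ×ˢ univ, prod_mem_nhds (Icc_mem_nhds (by linarith) (by linarith))
    univ_mem, ?_⟩
  -- On the strip over `[t - 1, t + 1]`, Tonelli reduces integrability to that of the continuous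
  -- function `s ↦ ‖c s‖`.
  rw [IntegrableOn, Measure.volume_eq_prod, ← Measure.prod_restrict, Measure.restrict_univ]
  have hm : AEStronglyMeasurable (fun p : ℝ × ℝ => u p.1 p.2)
      ((volume.restrict (Icc (t - 1) (t + 1))).prod volume) := by
    have := hu.restrict (s := Icc (t - 1) (t + 1) ×ˢ univ)
    rwa [Measure.volume_eq_prod, ← Measure.prod_restrict, Measure.restrict_univ] at this
  rw [integrable_prod_iff hm]
  refine ⟨Eventually.of_forall fun s => (integrable_coeFn (c s)).congr (h s).symm, ?_⟩
  have e : (fun s => ∫ y, ‖u s y‖) = fun s => ‖c s‖ := by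
    ext s
    rw [norm_L1_eq]
    apply integral_congr_ae
    filter_upwards [h s] with y hy
    rw [hy, Real.norm_eq_abs]
  simp only [e]
  exact hc.norm.continuousOn.integrableOn_Icc

theorem FluxHyp.aestronglyMeasurable_comp {f : ℝ → ℝ → ℝ} (hf : FluxHyp f) {u : ℝ → ℝ → ℝ}
    (hu : Measurable (fun p : ℝ × ℝ => u p.1 p.2)) :
    AEStronglyMeasurable (fun p : ℝ × ℝ => f p.2 (u p.1 p.2)) volume := by
  obtain ⟨g, hg, hfg⟩ := hf.exists_measurable
  have h1 : Measurable (fun p : ℝ × ℝ => g p.2 (u p.1 p.2)) := hg.comp (measurable_snd.prodMk hu)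
  refine h1.aestronglyMeasurable.congr ?_
  have h2 : ∀ᵐ p : ℝ × ℝ, ∀ w, f p.2 w = g p.2 w := by
    rw [Measure.volume_eq_prod]
    exact Measure.quasiMeasurePreserving_snd.ae hfg
  filter_upwards [h2] with p hp
  exact (hp _).symm

theorem continuous_nemytskii {f : ℝ → ℝ → ℝ} (hf : FluxHyp f) : Continuous (nemytskii hf) := by
  obtain ⟨L, hL0, hL⟩ := hf.lipschitz
  refine (LipschitzWith.of_dist_le_mul (K := ⟨L, hL0⟩) fun u w => ?_).continuous
  rw [dist_eq_norm, dist_eq_norm]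
  exact norm_nemytskii_sub_le hf hL u w

end Representative

/-! ### Space-time test functions paired with curves in `L¹` -/

section TestFunctions

theorem deriv_curry_left {Φ : ℝ × ℝ → ℝ} (h : Differentiable ℝ Φ) (p : ℝ × ℝ) :
    HasDerivAt (fun t => Φ (t, p.2)) (fderiv ℝ Φ p (1, 0)) p.1 := by
  have h1 : HasDerivAt (fun t : ℝ => (t, p.2)) ((1 : ℝ), (0 : ℝ)) p.1 :=
    (hasDerivAt_id p.1).prodMk (hasDerivAt_const _ _)
  exact (h p).hasFDerivAt.comp_hasDerivAt p.1 h1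

theorem deriv_curry_right {Φ : ℝ × ℝ → ℝ} (h : Differentiable ℝ Φ) (p : ℝ × ℝ) :
    HasDerivAt (fun x => Φ (p.1, x)) (fderiv ℝ Φ p (0, 1)) p.2 := by
  have h1 : HasDerivAt (fun x : ℝ => (p.1, x)) ((0 : ℝ), (1 : ℝ)) p.2 :=
    (hasDerivAt_const _ _).prodMk (hasDerivAt_id p.2)
  exact (h p).hasFDerivAt.comp_hasDerivAt p.2 h1

theorem continuous_deriv_left {φ : ℝ → ℝ → ℝ} (h : ContDiff ℝ 1 fun p : ℝ × ℝ => φ p.1 p.2) :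
    Continuous (fun p : ℝ × ℝ => deriv (fun t => φ t p.2) p.1) := by
  have e : (fun p : ℝ × ℝ => deriv (fun t => φ t p.2) p.1)
      = fun p => fderiv ℝ (fun p : ℝ × ℝ => φ p.1 p.2) p (1, 0) :=
    funext fun p => (deriv_curry_left (h.differentiable (by norm_num)) p).deriv
  rw [e]
  exact (h.continuous_fderiv (by norm_num)).clm_apply continuous_const

theorem hasCompactSupport_deriv_left {φ : ℝ → ℝ → ℝ}
    (h : ContDiff ℝ 1 fun p : ℝ × ℝ => φ p.1 p.2)
    (hc : HasCompactSupport fun p : ℝ × ℝ => φ p.1 p.2) :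
    HasCompactSupport (fun p : ℝ × ℝ => deriv (fun t => φ t p.2) p.1) := by
  have e : (fun p : ℝ × ℝ => deriv (fun t => φ t p.2) p.1)
      = fun p => fderiv ℝ (fun p : ℝ × ℝ => φ p.1 p.2) p (1, 0) :=
    funext fun p => (deriv_curry_left (h.differentiable (by norm_num)) p).deriv
  rw [e]
  exact hc.fderiv_apply (𝕜 := ℝ) _

theorem deriv_right_eq {φ : ℝ → ℝ → ℝ} {n : ℕ∞} (h : ContDiff ℝ (n + 1) fun p : ℝ × ℝ => φ p.1 p.2) :
    (fun p : ℝ × ℝ => deriv (φ p.1) p.2)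
      = fun p => fderiv ℝ (fun p : ℝ × ℝ => φ p.1 p.2) p (0, 1) :=
  funext fun p => (deriv_curry_right (h.differentiable (by simp)) p).deriv

theorem contDiff_deriv_right {φ : ℝ → ℝ → ℝ} {n : ℕ∞}
    (h : ContDiff ℝ (n + 1) fun p : ℝ × ℝ => φ p.1 p.2) :
    ContDiff ℝ n (fun p : ℝ × ℝ => deriv (φ p.1) p.2) := by
  rw [deriv_right_eq h]
  exact (h.fderiv_right le_rfl).clm_apply contDiff_const

theorem hasCompactSupport_deriv_right {φ : ℝ → ℝ → ℝ} {n : ℕ∞}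
    (h : ContDiff ℝ (n + 1) fun p : ℝ × ℝ => φ p.1 p.2)
    (hc : HasCompactSupport fun p : ℝ × ℝ => φ p.1 p.2) :
    HasCompactSupport (fun p : ℝ × ℝ => deriv (φ p.1) p.2) := by
  rw [deriv_right_eq h]
  exact hc.fderiv_apply (𝕜 := ℝ) _

theorem hasCompactSupport_slice {φ : ℝ → ℝ → ℝ}
    (hc : HasCompactSupport fun p : ℝ × ℝ => φ p.1 p.2) (t : ℝ) : HasCompactSupport (φ t) := by
  refine HasCompactSupport.intro (hc.isCompact.image continuous_snd) fun x hx => ?_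
  exact image_eq_zero_of_notMem_tsupport (f := fun p : ℝ × ℝ => φ p.1 p.2) (x := (t, x))
    fun h => hx ⟨_, h, rfl⟩

theorem contDiff_slice {φ : ℝ → ℝ → ℝ} {n : WithTop ℕ∞}
    (h : ContDiff ℝ n fun p : ℝ × ℝ => φ p.1 p.2) (t : ℝ) : ContDiff ℝ n (φ t) :=
  h.comp (contDiff_const.prodMk contDiff_id)

theorem contDiff_slice_left {φ : ℝ → ℝ → ℝ} {n : WithTop ℕ∞}
    (h : ContDiff ℝ n fun p : ℝ × ℝ => φ p.1 p.2) (x : ℝ) : ContDiff ℝ n (fun t => φ t x) :=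
  h.comp (contDiff_id.prodMk contDiff_const)

theorem exists_time_support {φ : ℝ → ℝ → ℝ} (hc : HasCompactSupport fun p : ℝ × ℝ => φ p.1 p.2)
    (hs : tsupport (fun p : ℝ × ℝ => φ p.1 p.2) ⊆ Ioi 0 ×ˢ univ) :
    ∃ T : ℝ, 0 < T ∧ ∀ t, t ≤ 0 ∨ T ≤ t →
      ∀ x, (t, x) ∉ tsupport (fun p : ℝ × ℝ => φ p.1 p.2) := by
  obtain ⟨R, hR0, hR⟩ := (hc.isCompact.image continuous_fst).isBounded.subset_ball_lt 0 0
  refine ⟨R, hR0, fun t ht x h => ?_⟩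
  have h1 : 0 < t := (hs h).1
  have h2 : t ∈ Metric.ball (0 : ℝ) R := hR ⟨_, h, rfl⟩
  rw [Metric.mem_ball, dist_zero_right, Real.norm_eq_abs, abs_of_pos h1] at h2
  rcases ht with ht | ht <;> linarith

theorem exists_lipschitz_time {φ : ℝ → ℝ → ℝ} (h : ContDiff ℝ 1 fun p : ℝ × ℝ => φ p.1 p.2)
    (hc : HasCompactSupport fun p : ℝ × ℝ => φ p.1 p.2) :
    ∃ M : ℝ, 0 ≤ M ∧ (∀ t x, |deriv (fun t => φ t x) t| ≤ M) ∧
      ∀ s t x, |φ s x - φ t x| ≤ M * |s - t| := by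
  obtain ⟨M, hM⟩ := (continuous_deriv_left h).bounded_above_of_compact_support
    (hasCompactSupport_deriv_left h hc)
  have hM' : ∀ t x, |deriv (fun t => φ t x) t| ≤ M := fun t x => hM (t, x)
  refine ⟨M, (norm_nonneg _).trans (hM 0), hM', fun s t x => ?_⟩
  exact convex_univ.norm_image_sub_le_of_norm_deriv_le (f := fun t => φ t x)
    (fun y _ => (contDiff_slice_left h x).differentiable (by norm_num) y) (fun y _ => hM' y x)
    (mem_univ t) (mem_univ s)

theorem hasDerivAt_integral_mul_time {φ : ℝ → ℝ → ℝ} (h : ContDiff ℝ 1 fun p : ℝ × ℝ => φ p.1 p.2)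
    (hc : HasCompactSupport fun p : ℝ × ℝ => φ p.1 p.2) (w : ℝ →₁[volume] ℝ) (t : ℝ) :
    HasDerivAt (fun s => ∫ x, w x * φ s x) (∫ x, w x * deriv (fun t => φ t x) t) t := by
  obtain ⟨M, hM0, hM, -⟩ := exists_lipschitz_time h hc
  have iw := integrable_coeFn w
  have hi : ∀ s, Integrable (fun x => w x * φ s x) := fun s =>
    integrable_mul_of_compactSupport iw (contDiff_slice h s).continuous (hasCompactSupport_slice hc s)
  refine (hasDerivAt_integral_of_dominated_loc_of_deriv_le (s := univ)
    (F := fun s x => w x * φ s x) (F' := fun s x => w x * deriv (fun t => φ t x) s)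
    (bound := fun x => |w x| * M) univ_mem (Eventually.of_forall fun s => (hi s).1) (hi t) ?_
    (Eventually.of_forall fun x s _ => ?_) (iw.abs.mul_const M)
    (Eventually.of_forall fun x s _ => ?_)).2
  · exact iw.1.mul ((continuous_deriv_left h).comp
      (continuous_const.prodMk continuous_id)).aestronglyMeasurable
  · rw [norm_mul, Real.norm_eq_abs, Real.norm_eq_abs]
    gcongr
    exact hM s x
  · exact ((contDiff_slice_left h x).differentiable (by norm_num) s).hasDerivAt.const_mul _

/-- A product rule needing only continuity of `c`: the remainder `∫ (c s - c t) (φ s - φ t)` is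
bounded by `M |s - t| ‖c s - c t‖ = o(|s - t|)`. -/
theorem exists_integral_mul_decomposition {φ : ℝ → ℝ → ℝ}
    (h : ContDiff ℝ 1 fun p : ℝ × ℝ => φ p.1 p.2)
    (hc : HasCompactSupport fun p : ℝ × ℝ => φ p.1 p.2) {c : ℝ → (ℝ →₁[volume] ℝ)}
    (hcc : Continuous c) (t : ℝ) :
    ∃ r : ℝ → ℝ, HasDerivAt r 0 t ∧ ∀ s, ∫ x, c s x * φ s x
      = (∫ x, c s x * φ t x) + (∫ x, c t x * φ s x) - (∫ x, c t x * φ t x) + r s := by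
  obtain ⟨M, hM0, -, hM⟩ := exists_lipschitz_time h hc
  have hi : ∀ (w : ℝ →₁[volume] ℝ) s, Integrable (fun x => w x * φ s x) := fun w s =>
    integrable_mul_of_compactSupport (integrable_coeFn w) (contDiff_slice h s).continuous
      (hasCompactSupport_slice hc s)
  refine ⟨fun s => ∫ x, (c s x - c t x) * (φ s x - φ t x), ?_, fun s => ?_⟩
  · have hb : ∀ s, |∫ x, (c s x - c t x) * (φ s x - φ t x)| ≤ M * |s - t| * ‖c s - c t‖ := by
      intro s
      rw [norm_L1_sub_eq]
      exact abs_integral_mul_le ((integrable_coeFn _).sub (integrable_coeFn _)) fun x => hM s t x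
    rw [hasDerivAt_iff_isLittleO, Asymptotics.isLittleO_iff]
    intro e he
    have h1 : Tendsto (fun s => M * ‖c s - c t‖) (𝓝 t) (𝓝 0) := by
      have : Continuous (fun s => M * ‖c s - c t‖) := by fun_prop
      have := this.tendsto t
      simpa using this
    filter_upwards [h1.eventually_lt_const he] with s hs
    simp only [sub_self, zero_mul, integral_zero, sub_zero, smul_zero, Real.norm_eq_abs]
    refine (hb s).trans ?_
    rw [mul_right_comm]
    gcongr
  · have i : ∀ w : ℝ →₁[volume] ℝ, Integrable (fun x => w x * φ s x - w x * φ t x) := fun w =>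
      (hi w s).sub (hi w t)
    have e : ∫ x, (c s x - c t x) * (φ s x - φ t x) = (∫ x, c s x * φ s x) - (∫ x, c s x * φ t x)
        - ((∫ x, c t x * φ s x) - ∫ x, c t x * φ t x) := by
      rw [← integral_sub (hi _ _) (hi _ _), ← integral_sub (hi _ _) (hi _ _),
        ← integral_sub (i _) (i _)]
      congr 1
      ext x
      ring
    simp only [e]
    ring

end TestFunctions

/-! ### From the right derivative to the weak equation -/

section WeakSolution

variable {f : ℝ → ℝ → ℝ}

theorem continuous_curve_pairing {φ : ℝ → ℝ → ℝ} (h : ContDiff ℝ 1 fun p : ℝ × ℝ => φ p.1 p.2)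
    (hc : HasCompactSupport fun p : ℝ × ℝ => φ p.1 p.2) {c : ℝ → (ℝ →₁[volume] ℝ)}
    (hcc : Continuous c) : Continuous (fun s => ∫ x, c s x * φ s x) := by
  rw [continuous_iff_continuousAt]
  intro t
  obtain ⟨r, hr, he⟩ := exists_integral_mul_decomposition h hc hcc t
  rw [funext he]
  have h1 : Continuous (fun s => ∫ x, c s x * φ t x) :=
    (continuous_integral_mul (contDiff_slice h t).continuous (hasCompactSupport_slice hc t)).comp hcc
  exact ((h1.continuousAt.add (hasDerivAt_integral_mul_time h hc (c t) t).continuousAt).sub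
    continuousAt_const).add hr.continuousAt

theorem hasDerivWithinAt_curve_pairing {φ : ℝ → ℝ → ℝ}
    (h : ContDiff ℝ 1 fun p : ℝ × ℝ => φ p.1 p.2)
    (hc : HasCompactSupport fun p : ℝ × ℝ => φ p.1 p.2) {c : ℝ → (ℝ →₁[volume] ℝ)}
    (hcc : Continuous c) {t b : ℝ} {s : Set ℝ}
    (hb : HasDerivWithinAt (fun s => ∫ x, c s x * φ t x) b s t) :
    HasDerivWithinAt (fun s => ∫ x, c s x * φ s x)
      (b + ∫ x, c t x * deriv (fun t => φ t x) t) s t := by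
  obtain ⟨r, hr, he⟩ := exists_integral_mul_decomposition h hc hcc t
  rw [funext he]
  have := ((hb.add (hasDerivAt_integral_mul_time h hc (c t) t).hasDerivWithinAt).sub_const
    (∫ x, c t x * φ t x)).add hr.hasDerivWithinAt
  rw [add_zero] at this
  exact this

/-- By Fubini, the space-time integral is the time integral of the right derivative of `t ↦ ∫ c t ·
φ t`. This pairing is continuous and vanishes at both ends of the time support. -/
theorem isWeakSolution_representative (hf : FluxHyp f) {ε : ℝ} {c : ℝ → (ℝ →₁[volume] ℝ)}
    (hcc : Continuous c)
    (hder : ∀ ψ : ℝ → ℝ, ContDiff ℝ 2 ψ → HasCompactSupport ψ → ∀ t : ℝ, 0 ≤ t →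
      HasDerivWithinAt (fun s : ℝ => ∫ x, c s x * ψ x) (weakForm f ε (c t) ψ) (Ioi t) t) :
    IsWeakSolution f ε (representative c) := by
  set u := representative c with hu
  have hum := measurable_representative hcc
  have hae : ∀ t, u t =ᵐ[volume] c t := representative_ae_eq c
  have hL1 : LocallyIntegrable (fun p : ℝ × ℝ => u p.1 p.2) volume :=
    locallyIntegrable_of_curve hcc hum.aestronglyMeasurable hae
  have hL2 : LocallyIntegrable (fun p : ℝ × ℝ => f p.2 (u p.1 p.2)) volume := by
    refine locallyIntegrable_of_curve (c := fun t => nemytskii hf (c t))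
      (u := fun t x => f x (u t x)) ((continuous_nemytskii hf).comp hcc)
      (hf.aestronglyMeasurable_comp hum) fun t => ?_
    filter_upwards [hae t, coeFn_nemytskii hf (c t)] with x h1 h2
    rw [h2, h1]
  refine ⟨hL1.locallyIntegrableOn _, hL2.locallyIntegrableOn _, fun φ hφ hc hs => ?_⟩
  have hφ1 : ContDiff ℝ 1 fun p : ℝ × ℝ => φ p.1 p.2 := hφ.of_le (by norm_num)
  have hφ2 : ContDiff ℝ (((1 : ℕ∞) : WithTop ℕ∞) + 1) fun p : ℝ × ℝ => φ p.1 p.2 := hφ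
  have hx1 := contDiff_deriv_right hφ2
  have hx1' : ContDiff ℝ (((0 : ℕ∞) : WithTop ℕ∞) + 1) fun p : ℝ × ℝ => deriv (φ p.1) p.2 := by
    simpa using hx1
  have hcx := hasCompactSupport_deriv_right hφ2 hc
  have hx2 := contDiff_deriv_right (φ := fun t => deriv (φ t)) hx1'
  have hcx2 := hasCompactSupport_deriv_right (φ := fun t => deriv (φ t)) hx1' hcx
  have it := hL1.integrable_smul_left_of_hasCompactSupport (continuous_deriv_left hφ1)
    (hasCompactSupport_deriv_left hφ1 hc)
  have ix := hL2.integrable_smul_left_of_hasCompactSupport hx1.continuous hcx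
  have ixx := (hL1.integrable_smul_left_of_hasCompactSupport hx2.continuous hcx2).const_mul ε
  set G : ℝ × ℝ → ℝ := fun p => u p.1 p.2 * deriv (fun t => φ t p.2) p.1
        + f p.2 (u p.1 p.2) * deriv (φ p.1) p.2
        + ε * u p.1 p.2 * deriv (deriv (φ p.1)) p.2 with hG
  have hGi : Integrable G (volume.prod volume) := by
    rw [← Measure.volume_eq_prod]
    refine ((it.add ix).add ixx).congr (Eventually.of_forall fun p => ?_)
    simp only [hG, Pi.add_apply, smul_eq_mul]
    ring
  obtain ⟨T, hT0, hT⟩ := exists_time_support hc hs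
  -- Vanishing off the support of `φ` allows integration over the whole plane and restricts time to
  -- `(0, T]`.
  have hGz : ∀ p : ℝ × ℝ, p ∉ tsupport (fun p : ℝ × ℝ => φ p.1 p.2) → G p = 0 := by
    intro p hp
    have hz : ∀ᶠ q in 𝓝 p, φ q.1 q.2 = 0 :=
      notMem_tsupport_iff_eventuallyEq.1 hp
    have h1 : deriv (fun t => φ t p.2) p.1 = 0 := by
      have : (fun t => φ t p.2) =ᶠ[𝓝 p.1] fun _ => 0 :=
        ((continuous_id.prodMk continuous_const).tendsto' p.1 p rfl).eventually hz
      rw [this.deriv_eq, deriv_const]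
    have h2 : φ p.1 =ᶠ[𝓝 p.2] fun _ => 0 :=
      ((continuous_const.prodMk continuous_id).tendsto' p.2 p rfl).eventually hz
    have h3 : deriv (φ p.1) p.2 = 0 := by rw [h2.deriv_eq, deriv_const]
    have h4 : deriv (deriv (φ p.1)) p.2 = 0 := by
      rw [h2.deriv.deriv_eq]
      simp
    simp [hG, h1, h3, h4]
  have hGslice : ∀ t, ∫ x, G (t, x)
      = weakForm f ε (c t) (φ t) + ∫ x, c t x * deriv (fun t => φ t x) t := by
    intro t
    have ic := integrable_coeFn (c t)
    have hφt := contDiff_slice hφ t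
    have hct := hasCompactSupport_slice hc t
    have i1 : Integrable (fun x => f x (c t x) * deriv (φ t) x) := integrable_mul_of_compactSupport
      (hf.integrable_comp ic) (contDiff_one_deriv hφt).continuous hct.deriv
    have i2 : Integrable (fun x => c t x * deriv (deriv (φ t)) x) :=
      integrable_mul_of_compactSupport ic (continuous_deriv_deriv hφt) hct.deriv.deriv
    have i3 : Integrable (fun x => c t x * deriv (fun t => φ t x) t) := by
      have hcl : HasCompactSupport (fun x => deriv (fun t => φ t x) t) :=
        hasCompactSupport_slice (φ := fun t x => deriv (fun t => φ t x) t)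
          (hasCompactSupport_deriv_left hφ1 hc) t
      exact integrable_mul_of_compactSupport ic
        ((continuous_deriv_left hφ1).comp (continuous_const.prodMk continuous_id)) hcl
    have i12 : Integrable (fun x => f x (c t x) * deriv (φ t) x
        + ε * (c t x * deriv (deriv (φ t)) x)) := i1.add (i2.const_mul ε)
    rw [weakForm, ← integral_const_mul, ← integral_add i1 (i2.const_mul ε), ← integral_add i12 i3]
    apply integral_congr_ae
    filter_upwards [hae t] with x hx
    simp only [hG, hx]
    ring
  rw [setIntegral_eq_integral_of_forall_compl_eq_zero fun p hp => hGz p fun h => hp (hs h)]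
  rw [Measure.volume_eq_prod, integral_prod _ hGi]
  have hGt : ∀ t, t ∉ Ioc 0 T → ∫ x, G (t, x) = 0 := by
    intro t ht
    have ht' : t ≤ 0 ∨ T < t := by
      by_contra! h'
      exact ht h'
    rw [← integral_zero ℝ ℝ (μ := volume)]
    congr 1
    ext x
    exact hGz _ (hT t (ht'.imp_right le_of_lt) x)
  rw [← setIntegral_eq_integral_of_forall_compl_eq_zero (s := Ioc 0 T) fun t ht => hGt t ht,
    ← intervalIntegral.integral_of_le hT0.le,
    intervalIntegral.integral_eq_sub_of_hasDeriv_right (f := fun s => ∫ x, c s x * φ s x)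
      (continuous_curve_pairing hφ1 hc hcc).continuousOn ?_
      hGi.integral_prod_left.intervalIntegrable]
  · have hz : ∀ t, t ≤ 0 ∨ T ≤ t → ∀ x, φ t x = 0 := fun t ht x =>
      image_eq_zero_of_notMem_tsupport (f := fun p : ℝ × ℝ => φ p.1 p.2) (hT t ht x)
    simp [hz T (Or.inr le_rfl), hz 0 (Or.inl le_rfl)]
  · intro t ht
    rw [min_eq_left hT0.le] at ht
    rw [hGslice]
    exact hasDerivWithinAt_curve_pairing hφ1 hc hcc
      (hder (φ t) (contDiff_slice hφ t) (hasCompactSupport_slice hc t) t ht.1.le)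

end WeakSolution

end NonlinearSemigroup

open NonlinearSemigroup in
theorem mainTheorem5 (f : ℝ → ℝ → ℝ) (hf : NonlinearSemigroup.FluxHyp f)
    (ε : ℝ) (hε : 0 < ε) :
    closure (NonlinearSemigroup.domain (NonlinearSemigroup.viscousOperator f ε)) = Set.univ ∧
    ∃ S : ℝ≥0 → (ℝ →₁[volume] ℝ) → (ℝ →₁[volume] ℝ),
      NonlinearSemigroup.Generates (NonlinearSemigroup.viscousOperator f ε) S ∧
      ∀ ubar : ℝ →₁[volume] ℝ,
        Continuous (fun t : ℝ≥0 => S t ubar) ∧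
        ∃ u : ℝ → ℝ → ℝ,
          (∀ t : ℝ≥0, u (t : ℝ) =ᵐ[volume] (S t ubar : ℝ → ℝ)) ∧
          NonlinearSemigroup.IsWeakSolution f ε u := by
  obtain ⟨L, hL0, hL⟩ := hf.lipschitz
  have hA := isAccretive_viscousOperator hf hε
  have hR := hasFullRange_viscousOperator hf hε hL0 hL
  have hd := closure_domain_viscousOperator hf hε
  have h₀ : 0 < ε / (4 * (L + 1) ^ 2) := by positivity
  refine ⟨hd, semigroup (viscousOperator f ε), generates_semigroup hA hR h₀ hd, fun w => ?_⟩
  have hcont := continuous_semigroup hA hR h₀ hd w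
  -- Composing with `Real.toNNReal` freezes negative times at time `0`, giving a continuous curve on
  -- all of `ℝ`.
  refine ⟨hcont, representative fun t => semigroup (viscousOperator f ε) t.toNNReal w,
    fun t => ?_, ?_⟩
  · have h := representative_ae_eq (fun t => semigroup (viscousOperator f ε) t.toNNReal w) t
    simpa only [Real.toNNReal_coe] using h
  · exact isWeakSolution_representative hf (hcont.comp continuous_real_toNNReal)
      fun ψ hψ hc t ht => hasDerivWithinAt_integral_semigroup hf hε hR h₀ w hψ hc ht
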